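/- Write $e(x)=e^{2\pi i x}$ and, for integers $m,n$ and a natural number $q\ge 1$, let $$S(m,n;q)=\sum_{\substack{x \bmod q\\ (x,q)=1}} e\Big(\frac{mx+n\overline{x}}{q}\Big),\qquad x\overline{x}\equiv 1 \pmod q,$$ be the Kloosterman sum. For an integer $\delta\equiv 0,1 \pmod 4$ and a natural number $q\ge 1$ put $$\rho_q(\delta)=\#\{x \bmod 2q : x^2\equiv \delta \pmod{4q}\},\qquad \lambda_q(\delta)=\sum_{q_1^2q_2q_3=q}\mu(q_2)\rho_{q_3}(\delta),$$ where $\mu$ is the Möbius function and $q_1,q_2,q_3$ run over natural numbers. For every natural number $q\ge 1$ and every integer $n\ge 3$, $$\rho_q(n^2-4)=\frac1q\sum_{k \bmod q} e\Big(\frac{kn}{q}\Big)S(k,k;q)$$ and $$\lambda_q(n^2-4)=\sum_{q_1^2q_2=q}\frac1{q_2}\sum_{k \bmod q_2} e\Big(\frac{kn}{q_2}\Big)S(k^2,1;q_2).$$ Moreover, for every $\varepsilon>0$ there is a constant $C$ depending only on $\varepsilon$ such that, for every natural number $q\ge 1$, written as $q=a^2b$ with $b$ squarefree, and every real $z\ge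 2$, $$\Big|\sum_{1\le n\le z}\lambda_q(n^2-4)-z\,\frac{\mu(b)}{b}\Big|\le C\,q^{\frac12+\varepsilon}.$$ -/

import Mathlib

namespace KloostermanLambda

/-- The additive character `e(x) = exp(2πix)`. -/
noncomputable def e (x : ℝ) : ℂ := Complex.exp (2 * Real.pi * Complex.I * x)

/-- The Kloosterman sum `S(m, n; q)`: the sum of `e((m x + n x̄) / q)` over the residues `x` modulo
`q` that are coprime to `q`, where `x x̄ ≡ 1` modulo `q`. -/
noncomputable def S (m n : ℤ) (q : ℕ) : ℂ :=
  ∑ x ∈ Finset.range q with Nat.Coprime x q,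
    e (((m : ℝ) * (x : ℝ) + (n : ℝ) * (((x : ZMod q)⁻¹).val : ℝ)) / (q : ℝ))

/-- `ρ_q(δ)`: the number of residues `x` modulo `2q` with `x² ≡ δ` modulo `4q`. -/
def rho (q : ℕ) (δ : ℤ) : ℕ :=
  (Finset.filter (fun x : ℕ => (x : ℤ) ^ 2 ≡ δ [ZMOD (4 * q : ℤ)]) (Finset.range (2 * q))).card

/-- `λ_q(δ)`: the sum of `μ(q₂) ρ_{q₃}(δ)` over all triples of natural numbers with
`q₁² q₂ q₃ = q` (for `q ≥ 1` such `q₁, q₂, q₃` are all divisors of `q`). -/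
def lam (q : ℕ) (δ : ℤ) : ℤ :=
  ∑ t ∈ q.divisors ×ˢ q.divisors ×ˢ q.divisors with t.1 ^ 2 * t.2.1 * t.2.2 = q,
    ArithmeticFunction.moebius t.2.1 * (rho t.2.2 δ : ℤ)

end KloostermanLambda

/-! The substitution x = 2y − n turns ρ_q(n² − 4) into the number of roots of y² − ny + 1 modulo q
(`rho_eq_card`). A root is a unit with y + y⁻¹ = n, and orthogonality of additive characters gives
the first formula. For the second, k²u + u⁻¹ + kn = u⁻¹((ku)² + n(ku) + 1), so the twisted average
of S(k², 1; q) is a mean over k of Ramanujan sums c_q(k² + nk + 1) (`klAverage_eq_ramanujanSum`).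
Since the c_d(m) with d ∣ q add up to q or 0 according as q ∣ m or not, the averages over d ∣ q add
up to ρ_q, and Möbius inversion gives λ_q.

For the mean value, the second formula is summed over n. The term k = 0 contributes S(0, 1; d) =
μ(d), and among the decompositions q = c²d only the one with d = b squarefree survives: this is the
main term. For k ≠ 0 the sum over n is geometric, and the errors are controlled by |S(k², 1; d)| ≤
8^ω(d) √d (`norm_kl_le`); the entry 1 spares any gcd factor.

That bound is multiplicative by the Chinese remainder theorem. Higher prime powers are handled by
averaging over u ↦ u(1 + πt). Odd primes need Weil's bound (`norm_kl_prime_le`), proved here from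
scratch. Passing from K to its quadratic extension L, kl_K² + kl_L = 2|K|
(`kl_sq_add_kl_quadratic`), so normalised sums evolve by t ↦ 2 − t². All later terms are at most 2,
and a start with |t| > 2 runs off to −∞. Summed over dilates, the Kloosterman sums count the zeros
of Tr(au + bu⁻¹), and Stepanov's method bounds this count from below through the curve y^p − y = au
+ bu⁻¹ (`le_card_artinSchreier`). The one-sided estimate already excludes |t| > 2. -/

namespace KloostermanLambda

/-! ### Stepanov's method -/

open Polynomial in
lemma pow_dvd_hasseDeriv_pow_mul {K : Type*} [Field K] (f s : K[X]) (N i : ℕ) :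
    f ^ (N - i) ∣ hasseDeriv i (f ^ N * s) := by
  induction N generalizing i with
  | zero => simp
  | succ N ih =>
    rw [pow_succ', mul_assoc, hasseDeriv_mul]
    refine Finset.dvd_sum fun ab hab => ?_
    obtain ⟨a, b⟩ := ab
    replace hab : a + b = i := Finset.HasAntidiagonal.mem_antidiagonal.1 hab
    rcases Nat.eq_zero_or_pos a with rfl | ha
    · simp only [zero_add] at hab
      subst hab
      rw [hasseDeriv_zero']
      refine dvd_trans (pow_dvd_pow f (show N + 1 - b ≤ N - b + 1 by omega)) ?_
      rw [pow_succ']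
      exact mul_dvd_mul_left f (ih b)
    · exact dvd_mul_of_dvd_right (dvd_trans (pow_dvd_pow f (by omega)) (ih b)) _

-- Once the power of f is removed, a vanishing condition of order i concerns a polynomial whose
-- degree grows only by i deg f. This keeps the number of linear conditions in Stepanov's
-- construction small.
open Polynomial in
lemma exists_linearMap_hasseDeriv_pow_mul {K : Type*} [Field K] (f : K[X]) (hf : f ≠ 0)
    (N i : ℕ) (hi : i ≤ N) :
    ∃ L : K[X] →ₗ[K] K[X], (∀ s, hasseDeriv i (f ^ N * s) = f ^ (N - i) * L s) ∧
      ∀ s, (L s).natDegree ≤ s.natDegree + i * f.natDegree := by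
  choose t ht using fun s => pow_dvd_hasseDeriv_pow_mul f s N i
  have h0 : f ^ (N - i) ≠ 0 := pow_ne_zero _ hf
  refine ⟨{ toFun := t, map_add' := fun x y => ?_, map_smul' := fun c x => ?_ }, ht, fun s => ?_⟩
  · apply mul_left_cancel₀ h0
    rw [← ht, mul_add, mul_add, map_add, ht, ht]
  · apply mul_left_cancel₀ h0
    rw [← ht, RingHom.id_apply, mul_smul_comm, mul_smul_comm, map_smul, ht]
  · change (t s).natDegree ≤ _
    by_cases hts : t s = 0
    · simp [hts]
    have h1 := natDegree_hasseDeriv_le (f ^ N * s) i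
    have h2 : (f ^ N * s).natDegree ≤ N * f.natDegree + s.natDegree := by
      refine natDegree_mul_le.trans ?_
      rw [natDegree_pow]
    rw [ht, natDegree_mul h0 hts, natDegree_pow, Nat.sub_mul] at h1
    have h3 := Nat.mul_le_mul_right f.natDegree hi
    omega

-- The q-th power fixes the coefficients, so f^q = f(X^q).
open Polynomial in
lemma X_pow_card_dvd_pow_card_sub {K : Type*} [Field K] [Fintype K] (f : K[X]) :
    (X : K[X]) ^ Fintype.card K ∣ f ^ Fintype.card K - C (f.coeff 0) := by
  have h : (X : K[X]) ∣ f - C (f.coeff 0) := by simp [X_dvd_iff]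
  have h2 := map_dvd (expand K (Fintype.card K)) h
  rwa [map_sub, expand_X, expand_C, FiniteField.expand_card] at h2

-- Modulo (X − x)^q one has X^q = x, so the factors X^(qj) behave as the constants x^j under Hasse
-- derivatives of order below q.
open Polynomial in
lemma X_sub_C_pow_dvd_sum {K : Type*} [Field K] [Fintype K] (J l : ℕ) (P : ℕ → K[X]) (x : K)
    (hl : l ≤ Fintype.card K)
    (h : ∀ i < l, ∑ j ∈ Finset.range J, (hasseDeriv i (P j)).eval x * x ^ j = 0) :
    (X - C x) ^ l ∣ ∑ j ∈ Finset.range J, P j * X ^ (Fintype.card K * j) := by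
  have key : (X : K[X]) ^ l ∣ taylor x (∑ j ∈ Finset.range J, P j * X ^ (Fintype.card K * j)) := by
    have h1 : (X : K[X]) ^ l ∣ taylor x (∑ j ∈ Finset.range J, P j * C (x ^ j)) := by
      rw [X_pow_dvd_iff]
      intro d hd
      rw [taylor_coeff, ← h d hd, map_sum, eval_finsetSum]
      refine Finset.sum_congr rfl fun j _ => ?_
      rw [mul_comm (P j), ← smul_eq_C_mul, map_smul, eval_smul, smul_eq_mul, mul_comm]
    rw [← sub_add_cancel (∑ j ∈ Finset.range J, P j * X ^ (Fintype.card K * j))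
      (∑ j ∈ Finset.range J, P j * C (x ^ j)), map_add]
    refine dvd_add ?_ h1
    rw [← Finset.sum_sub_distrib, map_sum]
    refine Finset.dvd_sum fun j _ => ?_
    rw [← mul_sub, taylor_mul]
    refine dvd_mul_of_dvd_right ((pow_dvd_pow X hl).trans ?_) _
    rw [map_sub, taylor_X_pow, taylor_C, pow_mul, ← FiniteField.expand_card (X + C x), map_add, expand_X,
      expand_C, C_pow]
    refine dvd_trans ?_ (sub_dvd_pow_sub_pow _ _ j)
    simp
  have h2 := map_dvd (taylorAlgHom (-x)) key
  simp only [taylorAlgHom_apply, taylor_pow, taylor_X, taylor_taylor, neg_add_cancel, taylor_zero] at h2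
  simpa [sub_eq_add_neg] using h2

open Polynomial in
/-- A squarefree nonconstant polynomial is not a constant times a square of a rational function. -/
lemma eq_zero_of_sq_mul_squarefree_eq {K : Type*} [Field K] {f r s : K[X]} {c : K}
    (hf : Squarefree f) (hdeg : 0 < f.natDegree) (hc : c ≠ 0) (h : r ^ 2 * f = s ^ 2 * C c) :
    s = 0 := by
  by_contra hs
  have hf0 : f ≠ 0 := hf.ne_zero
  have hr : r ≠ 0 := by
    rintro rfl
    simp [hs, hc] at h
  obtain ⟨g, hg, hgf⟩ := exists_irreducible_of_natDegree_pos hdeg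
  have hp : Prime g := hg.prime
  have e1 := congrArg (emultiplicity g) h
  rw [emultiplicity_mul hp, emultiplicity_mul hp, emultiplicity_pow hp, emultiplicity_pow hp] at e1
  have hC : emultiplicity g (C c) = 0 := by
    rw [emultiplicity_eq_zero]
    intro hd
    exact hg.not_isUnit (isUnit_of_dvd_unit hd (isUnit_C.2 hc.isUnit))
  have hf1 : emultiplicity g f = 1 := by
    refine le_antisymm ?_ ?_
    · have := (squarefree_iff_emultiplicity_le_one f).1 hf g
      rcases this with h | h
      · exact h
      · exact absurd h hg.not_isUnit
    · have := pow_dvd_iff_le_emultiplicity.1 (show g ^ 1 ∣ f by simpa using hgf)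
      simpa using this
  have fr : FiniteMultiplicity g r := FiniteMultiplicity.of_prime_left hp hr
  have fs : FiniteMultiplicity g s := FiniteMultiplicity.of_prime_left hp hs
  rw [hC, hf1, fr.emultiplicity_eq_multiplicity, fs.emultiplicity_eq_multiplicity] at e1
  norm_cast at e1
  omega

-- The auxiliary polynomial of Stepanov's method cannot vanish identically. Its lowest term r + f^M
-- s is divisible by X^q; multiplying by (r − f^M s) f gives r²f − s²f^q, which is r²f − s²f(0)
-- modulo X^q. The degree bound makes this zero, and squarefreeness of f then kills s and r.
open Polynomial in
lemma eq_zero_of_sum_add_mul_pow_eq_zero {K : Type*} [Field K] [Fintype K] {f : K[X]}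
    (hf : Squarefree f) (hdeg : 0 < f.natDegree) (hf0 : f.coeff 0 ≠ 0) (M : ℕ)
    (hM : 2 * M + 1 = Fintype.card K) (J D : ℕ) (hD : 2 * D + f.natDegree ≤ Fintype.card K + 1)
    (r s : ℕ → K[X]) (hr : ∀ j, r j ∈ degreeLT K D) (hs : ∀ j, s j ∈ degreeLT K D)
    (h : ∑ j ∈ Finset.range J, (r j + f ^ M * s j) * X ^ (Fintype.card K * j) = 0) :
    ∀ j < J, r j = 0 ∧ s j = 0 := by
  set q := Fintype.card K
  induction J generalizing r s with
  | zero => simp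
  | succ J ih =>
    rw [Finset.sum_range_succ'] at h
    have hdv : (X : K[X]) ^ q ∣ r 0 + f ^ M * s 0 := by
      have : r 0 + f ^ M * s 0 = - ∑ j ∈ Finset.range J,
          (r (j + 1) + f ^ M * s (j + 1)) * X ^ (q * (j + 1)) := by
        rw [eq_neg_iff_add_eq_zero, add_comm]
        simpa using h
      rw [this, dvd_neg]
      refine Finset.dvd_sum fun j _ => dvd_mul_of_dvd_right (pow_dvd_pow _ ?_) _
      exact Nat.le_mul_of_pos_right _ (Nat.succ_pos j)
    have hdv2 : (X : K[X]) ^ q ∣ r 0 ^ 2 * f - s 0 ^ 2 * C (f.coeff 0) := by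
      have e : r 0 ^ 2 * f - s 0 ^ 2 * C (f.coeff 0) =
          (r 0 + f ^ M * s 0) * (r 0 - f ^ M * s 0) * f
            + s 0 ^ 2 * (f ^ q - C (f.coeff 0)) := by
        rw [← hM]; ring
      rw [e]
      exact dvd_add (dvd_mul_of_dvd_left (dvd_mul_of_dvd_left hdv _) _)
        (dvd_mul_of_dvd_right (X_pow_card_dvd_pow_card_sub f) _)
    have hq : 0 < q := Fintype.card_pos
    have hzero : r 0 ^ 2 * f - s 0 ^ 2 * C (f.coeff 0) = 0 := by
      refine eq_zero_of_dvd_of_degree_lt hdv2 ?_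
      rw [degree_X_pow]
      rcases Nat.eq_zero_or_pos D with rfl | hDpos
      · have a1 : r 0 = 0 := by simpa [mem_degreeLT] using hr 0
        have a2 : s 0 = 0 := by simpa [mem_degreeLT] using hs 0
        simp [a1, a2]
      have nd : ∀ t ∈ degreeLT K D, t.natDegree ≤ D - 1 := by
        intro t ht
        rw [mem_degreeLT] at ht
        by_cases h0 : t = 0
        · simp [h0]
        have := (natDegree_lt_iff_degree_lt h0).2 ht
        omega
      have b : (r 0 ^ 2 * f - s 0 ^ 2 * C (f.coeff 0)).natDegree ≤ 2 * (D - 1) + f.natDegree := by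
        have h1 := nd _ (hr 0)
        have h2 := nd _ (hs 0)
        refine (natDegree_sub_le _ _).trans (max_le ?_ ?_)
        · refine natDegree_mul_le.trans ?_
          have := natDegree_pow_le (p := r 0) (n := 2)
          omega
        · refine natDegree_mul_le.trans ?_
          have := natDegree_pow_le (p := s 0) (n := 2)
          rw [natDegree_C]
          omega
      refine lt_of_le_of_lt degree_le_natDegree ?_
      exact_mod_cast (show _ < q by omega)
    have s0 : s 0 = 0 := eq_zero_of_sq_mul_squarefree_eq hf hdeg hf0 (sub_eq_zero.1 hzero)
    have r0 : r 0 = 0 := by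
      simpa [s0, hf.ne_zero] using hzero
    have h' : ∑ j ∈ Finset.range J, (r (j + 1) + f ^ M * s (j + 1)) * X ^ (q * j) = 0 := by
      have : (∑ j ∈ Finset.range J, (r (j + 1) + f ^ M * s (j + 1)) * X ^ (q * j)) * X ^ q = 0 := by
        rw [Finset.sum_mul, ← h, s0, r0]
        simp only [mul_zero, add_zero, zero_mul]
        refine Finset.sum_congr rfl fun j _ => ?_
        ring
      simpa using this
    have := ih (fun j => r (j + 1)) (fun j => s (j + 1)) (fun j => hr _) (fun j => hs _) h'
    intro j hj
    rcases j with _ | j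
    · exact ⟨r0, s0⟩
    · exact this j (by omega)

open Polynomial in
lemma natDegree_lt_of_mem_degreeLT {K : Type*} [Field K] {D : ℕ} {s : K[X]}
    (hs : s ∈ degreeLT K D) (hD : 0 < D) : s.natDegree < D := by
  by_cases h0 : s = 0
  · simpa [h0] using hD
  · exact (natDegree_lt_iff_degree_lt h0).2 (mem_degreeLT.1 hs)

open Polynomial in
/-- Siegel-type linear algebra: more unknown coefficients than linear conditions. -/
lemma exists_auxiliary_coefficients {K : Type*} [Field K] (J D l m : ℕ) (c : K)
    (L₁ L₂ : ℕ → K[X] →ₗ[K] K[X])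
    (h₁ : ∀ i < l, ∀ s, (L₁ i s).natDegree ≤ s.natDegree + i * m)
    (h₂ : ∀ i < l, ∀ s, (L₂ i s).natDegree ≤ s.natDegree + i * m) (hD : 0 < D)
    (hdim : l * (D + J + l * m) < 2 * (J * D)) :
    ∃ r s : ℕ → K[X], (∀ j, r j ∈ degreeLT K D) ∧ (∀ j, s j ∈ degreeLT K D) ∧
      (∃ j < J, ¬ (r j = 0 ∧ s j = 0)) ∧
      ∀ i < l, ∑ j ∈ Finset.range J, (L₁ i (r j) + c • L₂ i (s j)) * X ^ j = 0 := by
  classical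
  set E := D + J + l * m
  let V := Fin J → (degreeLT K D × degreeLT K D)
  let W := Fin l → Fin E → K
  have : Module.Finite K (degreeLT K D) := Module.Finite.equiv (degreeLTEquiv K D).symm
  let pr : Fin J → V →ₗ[K] (degreeLT K D × degreeLT K D) := fun j => LinearMap.proj j
  let T : Fin l → V →ₗ[K] K[X] := fun i => ∑ j : Fin J,
    (LinearMap.mulRight K (X ^ (j : ℕ) : K[X])) ∘ₗ
      ((L₁ i) ∘ₗ (degreeLT K D).subtype ∘ₗ LinearMap.fst K _ _ ∘ₗ pr j
        + c • ((L₂ i) ∘ₗ (degreeLT K D).subtype ∘ₗ LinearMap.snd K _ _ ∘ₗ pr j))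
  have hT : ∀ i v, T i v = ∑ j : Fin J, (L₁ i (v j).1 + c • L₂ i (v j).2) * X ^ (j : ℕ) := by
    intro i v
    simp only [T, pr, LinearMap.coe_sum, Finset.sum_apply, LinearMap.comp_apply, LinearMap.add_apply,
      LinearMap.smul_apply, LinearMap.mulRight_apply]
    rfl
  let Φ : V →ₗ[K] W := LinearMap.pi fun i => LinearMap.pi fun e => (lcoeff K (e : ℕ)) ∘ₗ T i
  have hdeg : Module.finrank K (degreeLT K D) = D := by
    rw [(degreeLTEquiv K D).finrank_eq]; simp
  have hfin : Module.finrank K W < Module.finrank K V := by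
    simp only [V, W, Module.finrank_pi_fintype, Module.finrank_prod, hdeg, Finset.sum_const,
      Finset.card_univ, Fintype.card_fin, smul_eq_mul, Module.finrank_self, mul_one]
    calc l * E < 2 * (J * D) := hdim
      _ = J * (D + D) := by ring
  have hker := LinearMap.ker_ne_bot_of_finrank_lt (f := Φ) hfin
  obtain ⟨v, hv, hv0⟩ := Submodule.exists_mem_ne_zero_of_ne_bot hker
  refine ⟨fun j => if h : j < J then (v ⟨j, h⟩).1 else 0,
    fun j => if h : j < J then (v ⟨j, h⟩).2 else 0, ?_, ?_, ?_, ?_⟩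
  · intro j
    dsimp only
    split_ifs
    · exact (v _).1.2
    · exact Submodule.zero_mem _
  · intro j
    dsimp only
    split_ifs
    · exact (v _).2.2
    · exact Submodule.zero_mem _
  · by_contra hcon
    push Not at hcon
    apply hv0
    funext j
    have := hcon j j.2
    simp only [j.2, dif_pos, Fin.eta, ZeroMemClass.coe_eq_zero] at this
    exact Prod.ext this.1 this.2
  · intro i hi
    have e : ∑ j ∈ Finset.range J, (L₁ i ((if h : j < J then ((v ⟨j, h⟩).1 : K[X]) else 0))
        + c • L₂ i ((if h : j < J then ((v ⟨j, h⟩).2 : K[X]) else 0))) * X ^ j = T ⟨i, hi⟩ v := by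
      rw [hT, Finset.sum_range]
      refine Finset.sum_congr rfl fun j _ => ?_
      simp [j.2]
    rw [e]
    ext e
    rw [coeff_zero]
    by_cases he : e < E
    · exact congrFun (congrFun (LinearMap.mem_ker.1 hv) ⟨i, hi⟩) ⟨e, he⟩
    · apply coeff_eq_zero_of_natDegree_lt
      refine lt_of_le_of_lt ?_ (show D - 1 + l * m + J < e by omega)
      rw [hT]
      refine natDegree_sum_le_of_forall_le _ _ fun j _ => ?_
      have d1 := natDegree_lt_of_mem_degreeLT (v j).1.2 hD
      have d2 := natDegree_lt_of_mem_degreeLT (v j).2.2 hD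
      have d3 := h₁ i hi (v j).1
      have d4 := h₂ i hi (v j).2
      have d5 := Nat.mul_le_mul_right m hi.le
      refine natDegree_mul_le.trans (add_le_add ?_ (by rw [natDegree_X_pow]; exact j.2.le))
      refine (natDegree_add_le _ _).trans (max_le (by dsimp only; omega) ?_)
      refine (natDegree_smul_le _ _).trans ?_
      dsimp only
      omega

open Polynomial in
/-- Stepanov's bound for the number of `x` in a finite field of square order at which a squarefree
polynomial takes a non-square value. -/
theorem two_mul_card_eval_pow_eq_neg_one_le {K : Type*} [Field K] [Fintype K] [DecidableEq K]
    {f : K[X]} (hf : Squarefree f) (hf0 : f.coeff 0 ≠ 0) (R M D : ℕ)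
    (hdeg : 0 < f.natDegree) (hR : Fintype.card K = R ^ 2) (hM : 2 * M + 1 = R ^ 2)
    (hD : 2 * D + f.natDegree = R ^ 2 + 1) (hRm : 2 * f.natDegree + 3 ≤ R) :
    2 * (Finset.univ.filter fun x : K => f.eval x ^ M = -1).card ≤
      R ^ 2 + (3 * f.natDegree + 2) * R + 2 * f.natDegree := by
  set m := f.natDegree with hm
  have hRodd : R % 2 = 1 := by
    rcases Nat.mod_two_eq_zero_or_one R with h | h
    · obtain ⟨k, rfl⟩ : ∃ k, R = 2 * k := ⟨R / 2, by omega⟩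
      have : (2 * k) ^ 2 = 2 * (2 * k ^ 2) := by ring
      omega
    · exact h
  -- R is odd, so J is an integer; with 2m + 3 ≤ R this choice leaves more unknowns than conditions
  -- in `hdim`.
  obtain ⟨J, hJ⟩ : ∃ J, 2 * J = R + 2 * m + 3 := ⟨(R + 2 * m + 3) / 2, by omega⟩
  have hfne : f ≠ 0 := hf.ne_zero
  have hDpos : 0 < D := by nlinarith
  have A₁ : ∀ i, ∃ L : K[X] →ₗ[K] K[X], i < R →
      (∀ s, hasseDeriv i (f ^ R * s) = f ^ (R - i) * L s) ∧
      ∀ s, (L s).natDegree ≤ s.natDegree + i * m := by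
    intro i
    by_cases hi : i < R
    · obtain ⟨L, hL⟩ := exists_linearMap_hasseDeriv_pow_mul f hfne R i hi.le
      exact ⟨L, fun _ => hL⟩
    · exact ⟨0, fun h => absurd h hi⟩
  have A₂ : ∀ i, ∃ L : K[X] →ₗ[K] K[X], i < R →
      (∀ s, hasseDeriv i (f ^ (R + M) * s) = f ^ (R + M - i) * L s) ∧
      ∀ s, (L s).natDegree ≤ s.natDegree + i * m := by
    intro i
    by_cases hi : i < R
    · obtain ⟨L, hL⟩ := exists_linearMap_hasseDeriv_pow_mul f hfne (R + M) i (by omega)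
      exact ⟨L, fun _ => hL⟩
    · exact ⟨0, fun h => absurd h hi⟩
  choose L₁ hL₁ using A₁
  choose L₂ hL₂ using A₂
  have hdim : R * (D + J + R * m) < 2 * (J * D) := by
    zify at hJ hD hRm ⊢
    have e1 : 2 * (2 * ((J : ℤ) * D)) = (R + 2 * m + 3) * (R ^ 2 + 1 - m) := by
      rw [← hJ, ← hD]; ring
    have e2 : 2 * ((R : ℤ) * (D + J + R * m)) =
        R * ((R ^ 2 + 1 - m) + (R + 2 * m + 3) + 2 * R * m) := by
      rw [← hJ, ← hD]; ring
    have hm0 : (0 : ℤ) ≤ m := by positivity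
    have hmpos : (1 : ℤ) ≤ m := by exact_mod_cast hdeg
    nlinarith [mul_nonneg hm0 hm0]
  -- The coefficient −1 is the value of f^M at the points being counted.
  obtain ⟨r, s, hr, hs, ⟨j₀, hj₀, hne⟩, hvan⟩ := exists_auxiliary_coefficients J D R m (-1 : K) L₁ L₂
    (fun i hi => (hL₁ i hi).2) (fun i hi => (hL₂ i hi).2) hDpos hdim
  set q := Fintype.card K with hq
  set G : K[X] := ∑ j ∈ Finset.range J, (r j + f ^ M * s j) * X ^ (q * j) with hG
  have hGne : G ≠ 0 := fun h => hne
    (eq_zero_of_sum_add_mul_pow_eq_zero hf hdeg hf0 M (by rw [hM, ← hR]) J D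
      (by rw [← hm, ← hq, hR, hD]) r s hr hs h j₀ hj₀)
  -- The factor f^R gives both parts of each Hasse derivative of order i < R the common factor f^(R
  -- − i); they then differ only by f^M = −1.
  set F := f ^ R * G with hF
  have hFne : F ≠ 0 := mul_ne_zero (pow_ne_zero _ hfne) hGne
  have hRq : R ≤ q := by rw [hR]; nlinarith
  have hdvd : ∀ x : K, f.eval x ^ M = -1 → (X - C x) ^ R ∣ F := by
    intro x hx
    have e : F = ∑ j ∈ Finset.range J, (f ^ R * r j + f ^ (R + M) * s j) * X ^ (q * j) := by
      rw [hF, hG, Finset.mul_sum]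
      refine Finset.sum_congr rfl fun j _ => ?_
      rw [pow_add]; ring
    rw [e]
    refine X_sub_C_pow_dvd_sum J R _ x hRq fun i hi => ?_
    have h := congrArg (eval x) (hvan i hi)
    rw [eval_finsetSum, eval_zero] at h
    rw [← mul_zero (f.eval x ^ (R - i)), ← h, Finset.mul_sum]
    refine Finset.sum_congr rfl fun j _ => ?_
    rw [map_add, (hL₁ i hi).1, (hL₂ i hi).1, show R + M - i = R - i + M by omega, pow_add]
    simp only [eval_add, eval_mul, eval_pow, eval_X, eval_smul, hx, smul_eq_mul]
    ring
  have hcount : R * (Finset.univ.filter fun x : K => f.eval x ^ M = -1).card ≤ F.natDegree := by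
    have hprod : ∏ x ∈ Finset.univ.filter (fun x : K => f.eval x ^ M = -1), (X - C x) ^ R ∣ F := by
      refine Finset.prod_dvd_of_coprime (fun x _ y _ hxy => ?_) fun x hx =>
        hdvd x (Finset.mem_filter.1 hx).2
      exact (pairwise_coprime_X_sub_C Function.injective_id hxy).pow
    have h1 := natDegree_le_of_dvd hprod hFne
    rw [natDegree_prod _ _ fun x _ => pow_ne_zero _ (X_sub_C_ne_zero x)] at h1
    simpa [mul_comm] using h1
  have hFdeg : F.natDegree ≤ R * m + (D + M * m + q * (J - 1)) := by
    refine natDegree_mul_le.trans (add_le_add (by rw [natDegree_pow]) ?_)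
    refine natDegree_sum_le_of_forall_le _ _ fun j hj => ?_
    have hj' : j ≤ J - 1 := by have := Finset.mem_range.1 hj; omega
    refine natDegree_mul_le.trans (add_le_add ?_ ?_)
    · have d1 := natDegree_lt_of_mem_degreeLT (hr j) hDpos
      have d2 := natDegree_lt_of_mem_degreeLT (hs j) hDpos
      refine (natDegree_add_le _ _).trans (max_le (by omega) ?_)
      refine natDegree_mul_le.trans ?_
      rw [natDegree_pow, ← hm]
      omega
    · rw [natDegree_X_pow]
      exact Nat.mul_le_mul_left _ hj'
  set N := (Finset.univ.filter fun x : K => f.eval x ^ M = -1).card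
  have hfinal : R * (2 * N) ≤ R * (R ^ 2 + (3 * m + 2) * R + 2 * m) := by
    obtain ⟨J', rfl⟩ : ∃ J', J = J' + 1 := ⟨J - 1, by omega⟩
    rw [Nat.add_sub_cancel] at hFdeg
    have h := hcount.trans hFdeg
    rw [hR] at h
    have h2 : 2 * (R * N) ≤ 2 * (R * m) + (R ^ 2 + 1 - m) + (2 * M) * m + R ^ 2 * (2 * J') := by
      have : 2 * D = R ^ 2 + 1 - m := by omega
      rw [← this]
      nlinarith
    rw [show 2 * M = R ^ 2 - 1 by omega, show 2 * J' = R + 2 * m + 1 by omega] at h2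
    have h3 : (R ^ 2 - 1) * m ≤ R ^ 2 * m := Nat.mul_le_mul_right _ (Nat.sub_le _ _)
    have h4 : R ^ 2 + 1 - m ≤ R ^ 2 := by omega
    nlinarith
  exact Nat.le_of_mul_le_mul_left hfinal (by omega)

/-! ### Kloosterman sums over a finite field and its quadratic extension -/

/-- The Kloosterman sum attached to an additive character of a finite commutative ring. -/
noncomputable def kl {R : Type*} [CommRing R] [Fintype R] [DecidableEq R] (ψ : AddChar R ℂ)
    (a b : R) : ℂ :=
  ∑ u : Rˣ, ψ (a * u + b * (u⁻¹ : Rˣ))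

lemma kl_eq_sum_field {K : Type*} [Field K] [Fintype K] [DecidableEq K] (ψ : AddChar K ℂ)
    (a b : K) : kl ψ a b = ∑ x : K, if x = 0 then 0 else ψ (a * x + b * x⁻¹) := by
  have h : ∑ x : K, (if x = 0 then 0 else ψ (a * x + b * x⁻¹)) =
      ∑ x ∈ Finset.univ.filter (fun x : K => x ≠ 0), ψ (a * x + b * x⁻¹) := by
    rw [Finset.sum_filter]
    exact Finset.sum_congr rfl fun x _ => by by_cases hx : x = 0 <;> simp [hx]
  rw [h, kl]
  refine Finset.sum_bij (fun u _ => (u : K)) (fun u _ => by simp) (fun u _ v _ h => Units.ext h)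
    (fun x hx => ⟨Units.mk0 x (Finset.mem_filter.1 hx).2, Finset.mem_univ _, rfl⟩) fun u _ => by simp

/-- The powers of Frobenius exhaust the Galois group, so an element fixed by Frobenius is in the
base field. -/
lemma exists_algebraMap_eq_of_pow_card_eq {K L : Type*} [Field K] [Field L] [Fintype K]
    [Finite L] [Algebra K L] {x : L} (hx : x ^ Fintype.card K = x) : ∃ y, algebraMap K L y = x := by
  have : x ∈ (⊥ : IntermediateField K L) := by
    rw [IsGalois.mem_bot_iff_fixed]
    intro f
    obtain ⟨i, rfl⟩ := (FiniteField.bijective_frobeniusAlgEquivOfAlgebraic_pow K L).2 f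
    rw [AlgEquiv.coe_pow, FiniteField.coe_frobeniusAlgEquivOfAlgebraic]
    exact Function.iterate_fixed hx _
  exact IntermediateField.mem_bot.1 this

section QuadraticExtension

variable {K L : Type*} [Field K] [Field L] [Fintype K] [Fintype L] [Algebra K L]

lemma algebraMap_trace_of_finrank_two (h2 : Module.finrank K L = 2) (z : L) :
    algebraMap K L (Algebra.trace K L z) = z + z ^ Fintype.card K := by
  rw [FiniteField.algebraMap_trace_eq_sum_pow, h2, Nat.card_eq_fintype_card]
  simp [Finset.sum_range_succ]

lemma algebraMap_norm_of_finrank_two (h2 : Module.finrank K L = 2) (z : L) :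
    algebraMap K L (Algebra.norm K z) = z * z ^ Fintype.card K := by
  rw [FiniteField.algebraMap_norm_eq_prod_pow, h2, Nat.card_eq_fintype_card]
  simp [Finset.prod_range_succ]

lemma isSquare_algebraMap_of_finrank_two (h2 : Module.finrank K L = 2) (hK : ringChar K ≠ 2)
    (d : K) : IsSquare (algebraMap K L d) := by
  by_cases hd : d = 0
  · simp [hd]
  have hchar : ringChar L ≠ 2 := by rwa [← Algebra.ringChar_eq K L]
  rw [FiniteField.isSquare_iff hchar (by simpa using hd), Module.card_eq_pow_finrank (K := K), h2]
  have hodd := FiniteField.odd_card_of_char_ne_two hK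
  obtain ⟨k, hk⟩ : ∃ k, Fintype.card K = 2 * k + 1 := ⟨Fintype.card K / 2, by omega⟩
  -- Euler's criterion in L: (q² − 1)/2 is a multiple of q − 1, so it kills every nonzero element of
  -- K.
  have e : Fintype.card K ^ 2 / 2 = (Fintype.card K - 1) * (k + 1) := by
    rw [hk]
    have : (2 * k + 1) ^ 2 = 2 * (2 * k * (k + 1)) + 1 := by ring
    rw [this, Nat.add_sub_cancel]
    omega
  rw [e, pow_mul, ← map_pow, FiniteField.pow_card_sub_one_eq_one d hd, map_one, one_pow]

/-- The polynomial X² − sX + t splits in L with roots α, β. If Frobenius swaps distinct roots, the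
counts are 0 and 2; if it fixes distinct roots, 2 and 0; a double root gives 1 and 1. -/
lemma card_pairs_add_card_trace_norm [DecidableEq K] (h2 : Module.finrank K L = 2)
    (hK : ringChar K ≠ 2) (s t : K) :
    (Finset.univ.filter fun w : K × K => (w.1 + w.2, w.1 * w.2) = (s, t)).card +
      (Finset.univ.filter fun z : L => (Algebra.trace K L z, Algebra.norm K z) = (s, t)).card
      = 2 := by
  classical
  set q := Fintype.card K with hq
  have two_ne : (2 : L) ≠ 0 := Ring.two_ne_zero (by rwa [← Algebra.ringChar_eq K L])
  have hinj := (algebraMap K L).injective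
  obtain ⟨δ, hδ⟩ := isSquare_algebraMap_of_finrank_two (L := L) h2 hK (s ^ 2 - 4 * t)
  set S := algebraMap K L s with hS
  set T := algebraMap K L t with hT
  obtain ⟨α, β, hsum, hprod⟩ : ∃ α β : L, α + β = S ∧ α * β = T := by
    refine ⟨(S + δ) / 2, (S - δ) / 2, by field_simp; ring, ?_⟩
    have : δ * δ = S ^ 2 - 4 * T := by rw [← hδ, hS, hT, map_sub, map_mul, map_pow, map_ofNat]
    field_simp
    linear_combination -this
  have hroot : ∀ z w : L, z + w = S → z * w = T → (z = α ∧ w = β) ∨ (z = β ∧ w = α) := by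
    intro z w h1 h2
    have : (z - α) * (z - β) = 0 := by
      linear_combination hprod - h2 + z * h1 - z * hsum
    rcases mul_eq_zero.1 this with h | h
    · left; exact ⟨sub_eq_zero.1 h, by linear_combination h1 - hsum - h⟩
    · right; exact ⟨sub_eq_zero.1 h, by linear_combination h1 - hsum - h⟩
  have hpair : ∀ w : K × K, (w.1 + w.2, w.1 * w.2) = (s, t) ↔
      (algebraMap K L w.1 + algebraMap K L w.2 = S ∧
        algebraMap K L w.1 * algebraMap K L w.2 = T) := by
    intro w
    rw [Prod.mk.injEq, ← map_add, ← map_mul, hinj.eq_iff, hinj.eq_iff]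
  have htn : ∀ z : L, (Algebra.trace K L z, Algebra.norm K z) = (s, t) ↔
      (z + z ^ q = S ∧ z * z ^ q = T) := by
    intro z
    rw [Prod.mk.injEq, ← hinj.eq_iff, ← hinj.eq_iff (b := t), algebraMap_trace_of_finrank_two h2,
      algebraMap_norm_of_finrank_two h2]
  simp only [hpair, htn]
  have hfix : ∀ y : K, algebraMap K L y ^ q = algebraMap K L y := fun y => by
    rw [← map_pow, FiniteField.pow_card]
  have hqq : ∀ z : L, (z ^ q) ^ q = z := fun z => by
    rw [← pow_mul, ← sq, ← h2, hq, ← Module.card_eq_pow_finrank, FiniteField.pow_card]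
  have hSq : S ^ q = S := hfix s
  have hTq : T ^ q = T := hfix t
  have hadd : ∀ x y : L, (x + y) ^ q = x ^ q + y ^ q := fun x y =>
    map_add (FiniteField.frobeniusAlgHom K L) x y
  have hfrob : ∀ z w : L, z + w = S → z * w = T → z ^ q + w ^ q = S ∧ z ^ q * w ^ q = T := by
    intro z w h1 h2
    rw [← hadd, ← mul_pow, h1, h2]; exact ⟨hSq, hTq⟩
  by_cases hα : α ^ q = α
  · have hβ : β ^ q = β := by
      have := (hfrob α β hsum hprod).1
      rw [hα] at this
      linear_combination this - hsum
    obtain ⟨a, ha⟩ := exists_algebraMap_eq_of_pow_card_eq hα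
    obtain ⟨b, hb⟩ := exists_algebraMap_eq_of_pow_card_eq hβ
    by_cases hab : α = β
    · have e1 : (Finset.univ.filter fun w : K × K => algebraMap K L w.1 + algebraMap K L w.2 = S ∧
          algebraMap K L w.1 * algebraMap K L w.2 = T) = {(a, a)} := by
        ext w
        simp only [Finset.mem_filter, Finset.mem_univ, true_and, Finset.mem_singleton, Prod.ext_iff]
        constructor
        · rintro ⟨h1, h2⟩
          rcases hroot _ _ h1 h2 with h | h
          · exact ⟨hinj (by rw [h.1, ha]), hinj (by rw [h.2, ha, hab])⟩
          · exact ⟨hinj (by rw [h.1, ha, hab]), hinj (by rw [h.2, ha])⟩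
        · rintro ⟨h1, h2⟩
          rw [h1, h2, ha, ← hsum, ← hprod, ← hab]
          exact ⟨rfl, rfl⟩
      have e2 : (Finset.univ.filter fun z : L => z + z ^ q = S ∧ z * z ^ q = T) = {α} := by
        ext z
        simp only [Finset.mem_filter, Finset.mem_univ, true_and, Finset.mem_singleton]
        constructor
        · rintro ⟨h1, h2⟩
          rcases hroot _ _ h1 h2 with h | h
          · exact h.1
          · rw [h.1, hab]
        · rintro rfl
          rw [hα, ← hsum, ← hprod, ← hab]
          exact ⟨rfl, rfl⟩
      rw [e1, e2]; simp
    · have e1 : (Finset.univ.filter fun w : K × K => algebraMap K L w.1 + algebraMap K L w.2 = S ∧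
          algebraMap K L w.1 * algebraMap K L w.2 = T) = {(a, b), (b, a)} := by
        ext w
        simp only [Finset.mem_filter, Finset.mem_univ, true_and, Finset.mem_insert,
          Finset.mem_singleton, Prod.ext_iff]
        constructor
        · rintro ⟨h1, h2⟩
          rcases hroot _ _ h1 h2 with h | h
          · exact Or.inl ⟨hinj (by rw [h.1, ha]), hinj (by rw [h.2, hb])⟩
          · exact Or.inr ⟨hinj (by rw [h.1, hb]), hinj (by rw [h.2, ha])⟩
        · rintro (⟨h1, h2⟩ | ⟨h1, h2⟩)
          · rw [h1, h2, ha, hb]; exact ⟨hsum, hprod⟩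
          · rw [h1, h2, ha, hb, add_comm, mul_comm]; exact ⟨hsum, hprod⟩
      have e2 : (Finset.univ.filter fun z : L => z + z ^ q = S ∧ z * z ^ q = T) = ∅ := by
        ext z
        simp only [Finset.mem_filter, Finset.mem_univ, true_and, Finset.notMem_empty, iff_false]
        rintro ⟨h1, h2⟩
        rcases hroot _ _ h1 h2 with ⟨rfl, h⟩ | ⟨rfl, h⟩
        · exact hab (hα.symm.trans h)
        · exact hab (h.symm.trans hβ)
      have hne : (a, b) ≠ (b, a) := by
        intro h
        have : a = b := congrArg Prod.fst h
        exact hab (by rw [← ha, ← hb, this])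
      rw [e1, e2, Finset.card_pair hne]; simp
  · have hαβ : α ^ q = β := by
      rcases hroot _ _ (hfrob α β hsum hprod).1 (hfrob α β hsum hprod).2 with h | h
      · exact absurd h.1 hα
      · exact h.1
    have hβα : β ^ q = α := by rw [← hαβ, hqq]
    have hab : α ≠ β := fun h => hα (by rw [hαβ, h])
    have e1 : (Finset.univ.filter fun w : K × K => algebraMap K L w.1 + algebraMap K L w.2 = S ∧
          algebraMap K L w.1 * algebraMap K L w.2 = T) = ∅ := by
      ext w
      simp only [Finset.mem_filter, Finset.mem_univ, true_and, Finset.notMem_empty, iff_false]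
      rintro ⟨h1, h2⟩
      rcases hroot _ _ h1 h2 with ⟨h, -⟩ | ⟨-, h⟩
      · exact hα (h ▸ hfix _)
      · exact hα (h ▸ hfix _)
    have e2 : (Finset.univ.filter fun z : L => z + z ^ q = S ∧ z * z ^ q = T) = {α, β} := by
      ext z
      simp only [Finset.mem_filter, Finset.mem_univ, true_and, Finset.mem_insert,
          Finset.mem_singleton]
      constructor
      · rintro ⟨h1, h2⟩
        rcases hroot _ _ h1 h2 with h | h
        · exact Or.inl h.1
        · exact Or.inr h.1
      · rintro (rfl | rfl)
        · rw [hαβ]; exact ⟨hsum, hprod⟩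
        · rw [hβα, add_comm, mul_comm]; exact ⟨hsum, hprod⟩
    rw [e1, e2, Finset.card_pair hab]; simp

lemma sum_pairs_add_sum_trace_norm [DecidableEq K] (h2 : Module.finrank K L = 2)
    (hK : ringChar K ≠ 2) (f : K × K → ℂ) :
    ∑ w : K × K, f (w.1 + w.2, w.1 * w.2) +
      ∑ z : L, f (Algebra.trace K L z, Algebra.norm K z) = 2 * ∑ w : K × K, f w := by
  rw [← Finset.sum_fiberwise (s := (Finset.univ : Finset (K × K)))
      (g := fun w : K × K => (w.1 + w.2, w.1 * w.2)),
    ← Finset.sum_fiberwise (s := (Finset.univ : Finset L))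
      (g := fun z : L => (Algebra.trace K L z, Algebra.norm K z)), ← Finset.sum_add_distrib,
    Finset.mul_sum]
  refine Finset.sum_congr rfl fun st _ => ?_
  have h1 : ∀ (s : Finset (K × K)), (∀ w ∈ s, (w.1 + w.2, w.1 * w.2) = st) →
      ∑ w ∈ s, f (w.1 + w.2, w.1 * w.2) = s.card * f st := fun s hs => by
    rw [Finset.sum_congr rfl fun w hw => by rw [hs w hw], Finset.sum_const, nsmul_eq_mul]
  have h3 : ∀ (s : Finset L), (∀ z ∈ s, (Algebra.trace K L z, Algebra.norm K z) = st) →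
      ∑ z ∈ s, f (Algebra.trace K L z, Algebra.norm K z) = s.card * f st := fun s hs => by
    rw [Finset.sum_congr rfl fun w hw => by rw [hs w hw], Finset.sum_const, nsmul_eq_mul]
  rw [h1 _ (fun w hw => (Finset.mem_filter.1 hw).2), h3 _ (fun w hw => (Finset.mem_filter.1 hw).2),
    ← add_mul, ← Nat.cast_add, card_pairs_add_card_trace_norm h2 hK]
  norm_num

/-- The Davenport–Hasse type relation between the Kloosterman sums over a finite field and over its
quadratic extension. -/
theorem kl_sq_add_kl_quadratic [DecidableEq K] [DecidableEq L] (h2 : Module.finrank K L = 2)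
    (hK : ringChar K ≠ 2) {ψ : AddChar K ℂ} (hψ : ψ.IsPrimitive) {a b : K} (ha : a ≠ 0)
    (hb : b ≠ 0) :
    kl ψ a b ^ 2 + kl (ψ.compAddMonoidHom (Algebra.trace K L).toAddMonoidHom) (algebraMap K L a)
      (algebraMap K L b) = 2 * Fintype.card K := by
  -- Both sums depend on their variables only through s = u + v, t = uv, respectively the trace and
  -- norm of z: the phase is s(a + b/t) in each case.
  let f : K × K → ℂ := fun w => if w.2 = 0 then 0 else ψ (w.1 * (a + b * w.2⁻¹))
  have e1 : kl ψ a b ^ 2 = ∑ w : K × K, f (w.1 + w.2, w.1 * w.2) := by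
    rw [kl_eq_sum_field, sq, Finset.sum_mul_sum, Fintype.sum_prod_type]
    refine Finset.sum_congr rfl fun u _ => Finset.sum_congr rfl fun v _ => ?_
    by_cases hu : u = 0
    · simp [f, hu]
    by_cases hv : v = 0
    · simp [f, hv]
    simp only [f, hu, hv, mul_eq_zero, or_self, if_false]
    rw [← AddChar.map_add_eq_mul]
    congr 1
    field_simp
    ring
  have e2 : kl (ψ.compAddMonoidHom (Algebra.trace K L).toAddMonoidHom) (algebraMap K L a)
      (algebraMap K L b) = ∑ z : L, f (Algebra.trace K L z, Algebra.norm K z) := by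
    rw [kl_eq_sum_field]
    refine Finset.sum_congr rfl fun z _ => ?_
    by_cases hz : z = 0
    · simp [f, hz]
    have hn : Algebra.norm K z ≠ 0 := Algebra.norm_ne_zero_iff.2 hz
    simp only [f, hz, hn, if_false, AddChar.compAddMonoidHom_apply, LinearMap.toAddMonoidHom_coe]
    congr 1
    have hzi : z⁻¹ = algebraMap K L (Algebra.norm K z)⁻¹ * (algebraMap K L (Algebra.trace K L z) - z)
        := by
      rw [map_inv₀, algebraMap_norm_of_finrank_two h2, algebraMap_trace_of_finrank_two h2]
      have : z ^ Fintype.card K ≠ 0 := pow_ne_zero _ hz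
      field_simp
      ring
    have htr : Algebra.trace K L (algebraMap K L (Algebra.trace K L z)) =
        2 * Algebra.trace K L z := by
      rw [Algebra.trace_algebraMap, h2, nsmul_eq_mul]; norm_num
    rw [hzi, ← mul_assoc, ← map_mul, ← Algebra.smul_def, ← Algebra.smul_def, map_add, map_smul,
      map_smul, map_sub, htr, smul_eq_mul, smul_eq_mul]
    ring
  have e3 : ∑ w : K × K, f w = Fintype.card K := by
    rw [Fintype.sum_prod_type_right]
    -- Summing over s leaves only the t with a + b/t = 0.
    have : ∀ t : K, ∑ s : K, f (s, t) = if t = -b * a⁻¹ then (Fintype.card K : ℂ) else 0 := by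
      intro t
      by_cases ht : t = 0
      · simp [f, ht, ha, hb]
      · simp only [f, ht, if_false]
        rw [AddChar.sum_mulShift _ hψ]
        have : a + b * t⁻¹ = 0 ↔ t = -b * a⁻¹ := by
          field_simp
          constructor <;> intro h <;> linear_combination h
        simp only [this]
        split_ifs <;> simp
    simp only [this, Finset.sum_ite_eq', Finset.mem_univ, if_true]
  rw [e1, e2, sum_pairs_add_sum_trace_norm h2 hK, e3]

end QuadraticExtension

/-! ### Artin–Schreier point counts -/

section TraceCharacter

variable {p : ℕ} [Fact p.Prime]

/-- The additive character of an extension of `𝔽_p` obtained by composing with the trace. -/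
noncomputable def traceChar (ψ : AddChar (ZMod p) ℂ) (K : Type*) [Field K] [Algebra (ZMod p) K] :
    AddChar K ℂ :=
  ψ.compAddMonoidHom (Algebra.trace (ZMod p) K).toAddMonoidHom

lemma traceChar_apply (ψ : AddChar (ZMod p) ℂ) (K : Type*) [Field K] [Algebra (ZMod p) K] (x : K) :
    traceChar ψ K x = ψ (Algebra.trace (ZMod p) K x) := rfl

lemma isPrimitive_traceChar {ψ : AddChar (ZMod p) ℂ} (hψ : ψ.IsPrimitive) (K : Type*) [Field K]
    [Finite K] [Algebra (ZMod p) K] : (traceChar ψ K).IsPrimitive := by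
  apply AddChar.IsPrimitive.of_ne_one
  have h1 : ψ ≠ 1 := by
    have := hψ one_ne_zero
    rwa [AddChar.mulShift_one] at this
  obtain ⟨x, hx⟩ := AddChar.ne_one_iff.1 h1
  obtain ⟨y, rfl⟩ := Algebra.trace_surjective (ZMod p) K x
  exact AddChar.ne_one_iff.2 ⟨y, hx⟩

lemma trace_pow_char_sub {K : Type*} [Field K] [Finite K] [Algebra (ZMod p) K] (y : K) :
    Algebra.trace (ZMod p) K (y ^ p - y) = 0 := by
  have h : Algebra.trace (ZMod p) K (y ^ p) = Algebra.trace (ZMod p) K y := by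
    have := Algebra.trace_eq_of_algEquiv (FiniteField.frobeniusAlgEquivOfAlgebraic (ZMod p) K) y
    rwa [FiniteField.coe_frobeniusAlgEquivOfAlgebraic, ZMod.card] at this
  rw [map_sub, h, sub_self]

/-- Orthogonality in c detects the vanishing of the trace. -/
lemma sum_kl_traceChar {ψ : AddChar (ZMod p) ℂ} (hψ : ψ.IsPrimitive) {K : Type*} [Field K]
    [Fintype K] [DecidableEq K] [Algebra (ZMod p) K] (a b : ZMod p) :
    ∑ c : ZMod p, kl (traceChar ψ K) (algebraMap (ZMod p) K (c * a)) (algebraMap (ZMod p) K (c * b)) =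
      ((p * (Finset.univ.filter fun u : Kˣ => Algebra.trace (ZMod p) K (algebraMap (ZMod p) K a * u +
        algebraMap (ZMod p) K b * (u⁻¹ : Kˣ)) = 0).card : ℕ) : ℂ) := by
  simp only [kl]
  rw [Finset.sum_comm, Finset.card_filter, Finset.mul_sum, Nat.cast_sum]
  refine Finset.sum_congr rfl fun u _ => ?_
  have : ∀ c : ZMod p, traceChar ψ K (algebraMap (ZMod p) K (c * a) * u +
      algebraMap (ZMod p) K (c * b) * (u⁻¹ : Kˣ)) = ψ (c * Algebra.trace (ZMod p) K
      (algebraMap (ZMod p) K a * u + algebraMap (ZMod p) K b * (u⁻¹ : Kˣ))) := by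
    intro c
    rw [traceChar_apply, ← smul_eq_mul (a := c) (b := Algebra.trace _ _ _), ← map_smul,
      Algebra.smul_def, mul_add, map_mul, map_mul, mul_assoc, mul_assoc]
  simp only [this]
  rw [AddChar.sum_mulShift _ hψ, ZMod.card]
  split_ifs <;> simp

/-- The trace vanishes on y^p − y, and each u has at most p preimages y. -/
lemma card_artinSchreier_le {K : Type*} [Field K] [Fintype K] [DecidableEq K] [Algebra (ZMod p) K]
    (a b : K) :
    (Finset.univ.filter fun w : K × Kˣ => w.1 ^ p - w.1 = a * w.2 + b * (w.2⁻¹ : Kˣ)).card ≤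
      p * (Finset.univ.filter fun u : Kˣ => Algebra.trace (ZMod p) K (a * u + b * (u⁻¹ : Kˣ)) = 0).card
      := by
  classical
  have hp1 : 1 < p := (Fact.out : p.Prime).one_lt
  refine Finset.card_le_mul_card_image_of_maps_to (f := Prod.snd) ?_ p ?_
  · rintro ⟨y, u⟩ h
    simp only [Finset.mem_filter, Finset.mem_univ, true_and] at h ⊢
    rw [← h, trace_pow_char_sub]
  · intro u _
    set w := a * (u : K) + b * (u⁻¹ : Kˣ) with hw
    let P : Polynomial K := Polynomial.X ^ p - Polynomial.X - Polynomial.C w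
    have hP : P.natDegree = p := by
      have := FiniteField.X_pow_card_sub_X_natDegree_eq K hp1
      rw [Polynomial.natDegree_sub_C, this]
    have hP0 : P ≠ 0 := by
      intro h
      rw [h, Polynomial.natDegree_zero] at hP
      omega
    refine le_trans (Finset.card_le_card_of_injOn (t := P.roots.toFinset) Prod.fst ?_ ?_) ?_
    · rintro ⟨y, v⟩ h
      simp only [Finset.coe_filter, Finset.mem_filter, Finset.mem_univ, true_and,
        Set.mem_ofPred_eq] at h
      obtain ⟨h1, rfl⟩ := h
      simp only [Multiset.mem_toFinset, Finset.mem_coe, Polynomial.mem_roots hP0,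
        Polynomial.IsRoot.def]
      simp [P, hw, h1]
    · rintro ⟨y, v⟩ h ⟨y', v'⟩ h' e
      simp only [Finset.coe_filter, Finset.mem_filter, Finset.mem_univ, true_and,
        Set.mem_ofPred_eq] at h h'
      exact Prod.ext e (h.2.trans h'.2.symm)
    · exact (Multiset.toFinset_card_le _).trans ((Polynomial.card_roots' P).trans hP.le)

/-- With w = y^n − y, the equation for u is au² − wu + b = 0, whose discriminant is w² − 4ab; a
nonzero square discriminant gives two distinct units. -/
lemma two_mul_card_square_le_card_artinSchreier {K : Type*} [Field K] [Fintype K] [DecidableEq K]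
    (hK : ringChar K ≠ 2) {a b : K} (ha : a ≠ 0) (hb : b ≠ 0) (n : ℕ) :
    2 * (Finset.univ.filter fun y : K =>
        (y ^ n - y) ^ 2 - 4 * a * b ≠ 0 ∧ IsSquare ((y ^ n - y) ^ 2 - 4 * a * b)).card ≤
      (Finset.univ.filter fun w : K × Kˣ => w.1 ^ n - w.1 = a * w.2 + b * (w.2⁻¹ : Kˣ)).card := by
  classical
  have two_ne : (2 : K) ≠ 0 := Ring.two_ne_zero hK
  set s := Finset.univ.filter fun w : K × Kˣ => w.1 ^ n - w.1 = a * w.2 + b * (w.2⁻¹ : Kˣ)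
  set A := Finset.univ.filter fun y : K =>
        (y ^ n - y) ^ 2 - 4 * a * b ≠ 0 ∧ IsSquare ((y ^ n - y) ^ 2 - 4 * a * b)
  refine le_trans ?_ (Finset.card_filter_le s fun w => w.1 ∈ A)
  refine Finset.mul_card_image_le_card_of_maps_to (f := Prod.fst)
    (fun w hw => (Finset.mem_filter.1 hw).2) 2 fun y hy => ?_
  obtain ⟨h0, δ, hδ⟩ := (Finset.mem_filter.1 hy).2
  have hδ0 : δ ≠ 0 := by rintro rfl; exact h0 (by rw [hδ, mul_zero])
  set w := y ^ n - y with hw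
  have hprod : ((w + δ) / (2 * a)) * ((w - δ) / (2 * a)) = b / a := by
    field_simp
    linear_combination hδ
  have hba : b / a ≠ 0 := div_ne_zero hb ha
  have n1 : (w + δ) / (2 * a) ≠ 0 := fun h => hba (by rw [← hprod, h, zero_mul])
  have n2 : (w - δ) / (2 * a) ≠ 0 := fun h => hba (by rw [← hprod, h, mul_zero])
  have hsum : (w + δ) / (2 * a) + (w - δ) / (2 * a) = w / a := by
    field_simp
    ring
  have hsol : ∀ x x' : K, x ≠ 0 → x + x' = w / a → x * x' = b / a → w = a * x + b * x⁻¹ := by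
    intro x x' hx h1 h2
    have h3 : w = a * (x + x') := by rw [h1]; field_simp
    have h4 : b = a * (x * x') := by rw [h2]; field_simp
    rw [h3, h4]; field_simp
  have hne : Units.mk0 _ n1 ≠ Units.mk0 _ n2 := by
    intro h
    have h := congrArg Units.val h
    rw [Units.val_mk0, Units.val_mk0] at h
    field_simp at h
    have : 2 * δ = 0 := by linear_combination h
    exact hδ0 ((mul_eq_zero.1 this).resolve_left two_ne)
  have hsub : ({(y, Units.mk0 _ n1), (y, Units.mk0 _ n2)} : Finset (K × Kˣ)) ⊆
      (s.filter fun w => w.1 ∈ A).filter fun w => w.1 = y := by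
    intro v hv
    simp only [Finset.mem_insert, Finset.mem_singleton] at hv
    rcases hv with rfl | rfl
    · refine Finset.mem_filter.2 ⟨Finset.mem_filter.2 ⟨Finset.mem_filter.2
        ⟨Finset.mem_univ _, ?_⟩, hy⟩, rfl⟩
      have := hsol _ _ n1 hsum hprod
      simpa using this
    · refine Finset.mem_filter.2 ⟨Finset.mem_filter.2 ⟨Finset.mem_filter.2
        ⟨Finset.mem_univ _, ?_⟩, hy⟩, rfl⟩
      have := hsol _ _ n2 (by rw [add_comm, hsum]) (by rw [mul_comm, hprod])
      simpa using this
  have := Finset.card_le_card hsub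
  rwa [Finset.card_pair (fun h => hne (congrArg Prod.snd h))] at this

end TraceCharacter

section Stepanov

open Polynomial

variable {K : Type*} [Field K] (n : ℕ) (c : K)

/-- The polynomial `(X ^ n - X) ^ 2 - c`. -/
noncomputable def discPoly : K[X] := (X ^ n - X) ^ 2 - C c

lemma eval_discPoly (y : K) : (discPoly n c).eval y = (y ^ n - y) ^ 2 - c := by
  simp [discPoly]

lemma natDegree_discPoly (hn : 1 < n) : (discPoly n c).natDegree = 2 * n := by
  rw [discPoly, natDegree_sub_C, natDegree_pow, FiniteField.X_pow_card_sub_X_natDegree_eq K hn]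

lemma coeff_zero_discPoly (hn : 1 < n) : (discPoly n c).coeff 0 = -c := by
  rw [coeff_zero_eq_eval_zero, eval_discPoly, zero_pow (by omega)]
  ring

/-- In characteristic p the derivative is −2(X^p − X), which yields an explicit Bézout identity. -/
lemma squarefree_discPoly (p : ℕ) [CharP K p] (h2 : (2 : K) ≠ 0) (hc : c ≠ 0) :
    Squarefree (discPoly p c) := by
  apply Separable.squarefree
  rw [separable_def]
  have hd : derivative (discPoly p c) = -(C 2 * (X ^ p - X)) := by
    simp only [discPoly, derivative_sub, derivative_pow, derivative_C, derivative_X,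
      CharP.cast_eq_zero, map_zero, zero_mul, sub_zero]
    simp
  refine ⟨C (-c⁻¹), C (-c⁻¹ * 2⁻¹) * (X ^ p - X), ?_⟩
  have e1 : (C (2⁻¹ : K)) * C 2 = 1 := by rw [← C_mul, inv_mul_cancel₀ h2, C_1]
  have e2 : C c⁻¹ * C c = 1 := by rw [← C_mul, inv_mul_cancel₀ hc, C_1]
  rw [hd, discPoly, C_mul, C_neg]
  linear_combination C c⁻¹ * (X ^ p - X) ^ 2 * e1 + e2

end Stepanov

/-! ### Weil's bound at odd primes -/

section Weil

variable {p : ℕ} [Fact p.Prime]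

/-- Stepanov's upper bound on nonsquare values of the discriminant becomes a lower bound on nonzero
square values, up to at most 2p roots. Each square value supplies two points. -/
lemma le_card_artinSchreier (hp2 : p ≠ 2) {K : Type*} [Field K] [Fintype K] [DecidableEq K]
    [Algebra (ZMod p) K] {a b : K} (ha : a ≠ 0) (hb : b ≠ 0) (R : ℕ)
    (hR : Fintype.card K = R ^ 2) (hRp : 4 * p + 3 ≤ R) :
    R ^ 2 ≤ (Finset.univ.filter fun w : K × Kˣ =>
      w.1 ^ p - w.1 = a * w.2 + b * (w.2⁻¹ : Kˣ)).card + (6 * p + 2) * R + 8 * p := by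
  classical
  have hp1 : 1 < p := (Fact.out : p.Prime).one_lt
  have : CharP K p := charP_of_injective_algebraMap (algebraMap (ZMod p) K).injective p
  have hK : ringChar K ≠ 2 := by rwa [ringChar.eq K p]
  have two_ne : (2 : K) ≠ 0 := Ring.two_ne_zero hK
  have hc : 4 * a * b ≠ 0 := by
    rw [show (4 : K) = 2 * 2 by norm_num]
    exact mul_ne_zero (mul_ne_zero (mul_ne_zero two_ne two_ne) ha) hb
  set f := discPoly p (4 * a * b) with hf
  have hdeg : f.natDegree = 2 * p := natDegree_discPoly p _ hp1
  have hodd := FiniteField.odd_card_of_char_ne_two hK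
  obtain ⟨M, hM⟩ : ∃ M, 2 * M + 1 = R ^ 2 := ⟨R ^ 2 / 2, by omega⟩
  have hRR : R ≤ R ^ 2 := by nlinarith
  have hst := two_mul_card_eval_pow_eq_neg_one_le (squarefree_discPoly (4 * a * b) p two_ne hc)
    (by rw [coeff_zero_discPoly _ _ hp1]; exact neg_ne_zero.2 hc) R M ((R ^ 2 + 1 - 2 * p) / 2)
    (by rw [← hf, hdeg]; omega) hR hM (by rw [← hf, hdeg]; omega) (by rw [← hf, hdeg]; omega)
  rw [← hf, hdeg] at hst
  have hlow := two_mul_card_square_le_card_artinSchreier hK ha hb p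
  set A := Finset.univ.filter fun y : K =>
        (y ^ p - y) ^ 2 - 4 * a * b ≠ 0 ∧ IsSquare ((y ^ p - y) ^ 2 - 4 * a * b)
  set B := Finset.univ.filter fun x : K => f.eval x ^ M = -1
  have hfne : f ≠ 0 := fun h => by rw [h, Polynomial.natDegree_zero] at hdeg; omega
  have hcover : (Finset.univ : Finset K) ⊆ A ∪ B ∪ f.roots.toFinset := by
    intro y _
    have he := eval_discPoly p (4 * a * b) y
    by_cases h0 : (y ^ p - y) ^ 2 - 4 * a * b = 0
    · refine Finset.mem_union_right _ ?_
      rw [Multiset.mem_toFinset, Polynomial.mem_roots hfne, Polynomial.IsRoot.def, hf, he, h0]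
    · refine Finset.mem_union_left _ ?_
      by_cases hs : IsSquare ((y ^ p - y) ^ 2 - 4 * a * b)
      · exact Finset.mem_union_left _ (Finset.mem_filter.2 ⟨Finset.mem_univ _, h0, hs⟩)
      · refine Finset.mem_union_right _ (Finset.mem_filter.2 ⟨Finset.mem_univ _, ?_⟩)
        rw [hf, he]
        rw [FiniteField.isSquare_iff hK h0, hR, show R ^ 2 / 2 = M by omega] at hs
        have := FiniteField.pow_dichotomy hK h0
        rw [hR, show R ^ 2 / 2 = M by omega] at this
        exact this.resolve_left hs
  have h1 := Finset.card_le_card hcover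
  rw [Finset.card_univ, hR] at h1
  have h2 := (Finset.card_union_le (A ∪ B) f.roots.toFinset)
  have h3 := Finset.card_union_le A B
  have h4 := (Multiset.toFinset_card_le f.roots).trans (Polynomial.card_roots' f)
  rw [hdeg] at h4
  have : (3 * (2 * p) + 2) * R = (6 * p + 2) * R := by ring
  omega

end Weil

/-- Replacing u by −u conjugates each term, so the sum is real. -/
lemma conj_kl {R : Type*} [CommRing R] [Fintype R] [DecidableEq R] (ψ : AddChar R ℂ) (a b : R) :
    (starRingEnd ℂ) (kl ψ a b) = kl ψ a b := by
  rw [kl, map_sum]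
  refine Fintype.sum_equiv (Equiv.neg Rˣ) _ _ fun u => ?_
  rw [← AddChar.map_neg_eq_conj]
  congr 1
  simp only [Equiv.neg_apply, inv_neg, Units.val_neg]
  ring

section Weil

variable {p : ℕ} [Fact p.Prime]

/-- Normalised Kloosterman sums over the successive quadratic extensions obey `t ↦ 2 - t ^ 2`. -/
lemma exists_tower (hp2 : p ≠ 2) {ψ : AddChar (ZMod p) ℂ} (hψ : ψ.IsPrimitive) (j : ℕ) :
    ∃ (K : Type) (_ : Field K) (_ : Fintype K) (_ : DecidableEq K) (_ : Algebra (ZMod p) K),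
      Fintype.card K = p ^ 2 ^ j ∧ ∀ a b : ZMod p, a ≠ 0 → b ≠ 0 →
        kl (traceChar ψ K) (algebraMap (ZMod p) K a) (algebraMap (ZMod p) K b) =
          ((√(p ^ 2 ^ j : ℝ) * (fun t : ℝ => 2 - t ^ 2)^[j] ((kl ψ a b).re / √p) : ℝ) : ℂ) := by
  have hp0 : (0 : ℝ) < p := by exact_mod_cast (Fact.out : p.Prime).pos
  induction j with
  | zero =>
    refine ⟨ZMod p, inferInstance, inferInstance, inferInstance, inferInstance, by simp [ZMod.card],
      fun a b _ _ => ?_⟩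
    have h1 : traceChar ψ (ZMod p) = ψ := by
      ext x
      rw [traceChar_apply, Algebra.trace_self_apply]
    have h2 : √(p : ℝ) ≠ 0 := (Real.sqrt_pos.2 hp0).ne'
    rw [h1, pow_zero, pow_one, Function.iterate_zero, id_eq, mul_div_cancel₀ _ h2]
    exact (Complex.conj_eq_iff_re.1 (conj_kl ψ a b)).symm
  | succ j ih =>
    obtain ⟨K, _, _, _, _, hcard, hkl⟩ := ih
    have : CharP K p := charP_of_injective_algebraMap (algebraMap (ZMod p) K).injective p
    have hK : ringChar K ≠ 2 := by rwa [ringChar.eq K p]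
    let L := FiniteField.Extension K p 2
    let _ : Fintype L := Fintype.ofFinite L
    let _ : DecidableEq L := Classical.decEq L
    have hfr : Module.finrank K L = 2 := FiniteField.finrank_extension K p 2
    refine ⟨L, inferInstance, inferInstance, inferInstance, inferInstance, ?_, fun a b ha hb => ?_⟩
    · rw [Module.card_eq_pow_finrank (K := K), hfr, hcard, ← pow_mul, pow_succ]
    have hchar : traceChar ψ L =
        (traceChar ψ K).compAddMonoidHom (Algebra.trace K L).toAddMonoidHom := by
      ext x
      rw [traceChar_apply, AddChar.compAddMonoidHom_apply, traceChar_apply,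
        LinearMap.toAddMonoidHom_coe, Algebra.trace_trace]
    have key := kl_sq_add_kl_quadratic (L := L) hfr hK (isPrimitive_traceChar hψ K)
      (a := algebraMap (ZMod p) K a) (b := algebraMap (ZMod p) K b) (by simpa using ha)
      (by simpa using hb)
    rw [← hchar, hkl a b ha hb, hcard, ← IsScalarTower.algebraMap_apply,
      ← IsScalarTower.algebraMap_apply] at key
    rw [eq_sub_of_add_eq' key, Function.iterate_succ_apply']
    have hs : √((p : ℝ) ^ 2 ^ (j + 1)) = (p : ℝ) ^ 2 ^ j := by
      rw [pow_succ 2 j, pow_mul, Real.sqrt_sq (by positivity)]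
    rw [hs]
    have hq : √((p : ℝ) ^ 2 ^ j) ^ 2 = (p : ℝ) ^ 2 ^ j := Real.sq_sqrt (by positivity)
    generalize (fun t : ℝ => 2 - t ^ 2)^[j] ((kl ψ a b).re / √p) = t
    norm_cast
    rw [mul_pow]
    push_cast at hq ⊢
    rw [hq]
    ring

lemma iterate_two_sub_sq_le_two (t : ℝ) (j : ℕ) : (fun t : ℝ => 2 - t ^ 2)^[j + 1] t ≤ 2 := by
  rw [Function.iterate_succ_apply']
  nlinarith [sq_nonneg ((fun t : ℝ => 2 - t ^ 2)^[j] t)]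

lemma iterate_two_sub_sq_le {t η : ℝ} (hη : 0 ≤ η) (ht : 4 + η ≤ t ^ 2) (j : ℕ) :
    (fun t : ℝ => 2 - t ^ 2)^[j + 1] t ≤ -2 - 4 ^ j * η := by
  induction j with
  | zero => simp; linarith
  | succ j ih =>
    rw [Function.iterate_succ_apply']
    have : 0 ≤ 4 ^ j * η := by positivity
    have h4 : (4 : ℝ) ^ (j + 1) * η = 4 * (4 ^ j * η) := by ring
    nlinarith

/-- **Weil's bound** for Kloosterman sums modulo an odd prime. -/
theorem norm_kl_prime_le (hp2 : p ≠ 2) {ψ : AddChar (ZMod p) ℂ} (hψ : ψ.IsPrimitive)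
    {a b : ZMod p} (ha : a ≠ 0) (hb : b ≠ 0) : ‖kl ψ a b‖ ≤ 2 * √p := by
  have hpp : p.Prime := Fact.out
  have hp0 : (0 : ℝ) < p := by exact_mod_cast hpp.pos
  have hp1 : 1 < p := hpp.one_lt
  by_contra! hcon
  set g : ℝ → ℝ := fun t => 2 - t ^ 2 with hg
  set T : ZMod p → ℝ := fun c => (kl ψ (c * a) (c * b)).re / √p with hT
  have hre : ∀ a b, kl ψ a b = ((kl ψ a b).re : ℂ) := fun a b =>
    (Complex.conj_eq_iff_re.1 (conj_kl ψ a b)).symm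
  obtain ⟨η, hη, hT1⟩ : ∃ η : ℝ, 0 < η ∧ 4 + η ≤ T 1 ^ 2 := by
    refine ⟨T 1 ^ 2 - 4, ?_, by linarith⟩
    have h1 : ‖kl ψ a b‖ ^ 2 = (kl ψ a b).re ^ 2 := by
      conv_lhs => rw [hre a b]
      rw [Complex.norm_real, Real.norm_eq_abs, sq_abs]
    have h2 : (2 * √p) ^ 2 < ‖kl ψ a b‖ ^ 2 := by
      have : 0 ≤ √(p : ℝ) := Real.sqrt_nonneg _
      nlinarith
    rw [h1, mul_pow, Real.sq_sqrt hp0.le] at h2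
    simp only [hT, one_mul, div_pow, Real.sq_sqrt hp0.le]
    rw [sub_pos, lt_div_iff₀ hp0]
    linarith
  have hbound : ∀ j : ℕ, 4 * p + 3 ≤ j → 4 ^ j * η ≤ 16 * p + 2 := by
    intro j hj
    obtain ⟨K, _, _, _, _, hcard, hkl⟩ := exists_tower hp2 hψ (j + 1)
    set R := p ^ 2 ^ j with hR
    have hRcard : Fintype.card K = R ^ 2 := by rw [hcard, hR, ← pow_mul, pow_succ]
    have hjR : 4 * p + 3 ≤ R := by
      have h1 : j < 2 ^ j := Nat.lt_two_pow_self
      have h2 : 2 ^ j < p ^ 2 ^ j := Nat.lt_pow_self hp1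
      omega
    have ha' : algebraMap (ZMod p) K a ≠ 0 := by simpa using ha
    have hb' : algebraMap (ZMod p) K b ≠ 0 := by simpa using hb
    have hlow := (le_card_artinSchreier hp2 ha' hb' R hRcard hjR).trans
      (Nat.add_le_add_right (Nat.add_le_add_right (card_artinSchreier_le _ _) _) _)
    have hsum := sum_kl_traceChar hψ (K := K) a b
    set N := p * (Finset.univ.filter fun u : Kˣ => Algebra.trace (ZMod p) K
      (algebraMap (ZMod p) K a * u + algebraMap (ZMod p) K b * (u⁻¹ : Kˣ)) = 0).card
    have hsq : √((p : ℝ) ^ 2 ^ (j + 1)) = R := by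
      rw [pow_succ 2 j, pow_mul, Real.sqrt_sq (by positivity), hR]; push_cast; rfl
    -- The dilate c = 0 gives the main term R² − 1 of the count.
    have h0 : kl (traceChar ψ K) 0 0 = ((R ^ 2 - 1 : ℝ) : ℂ) := by
      have hpos : 1 ≤ R ^ 2 := by nlinarith
      have : Fintype.card Kˣ = R ^ 2 - 1 := by
        rw [Fintype.card_units, hRcard]
      simp only [kl, zero_mul, add_zero, AddChar.map_zero_eq_one, Finset.sum_const,
        Finset.card_univ, this, nsmul_eq_mul, mul_one]
      push_cast [hpos]
      rfl
    have hne : ∀ c ∈ (Finset.univ : Finset (ZMod p)).erase 0,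
        kl (traceChar ψ K) (algebraMap (ZMod p) K (c * a)) (algebraMap (ZMod p) K (c * b)) =
          ((R * g^[j + 1] (T c) : ℝ) : ℂ) := by
      intro c hc
      have hc0 := Finset.ne_of_mem_erase hc
      rw [hkl _ _ (mul_ne_zero hc0 ha) (mul_ne_zero hc0 hb), hsq]
    rw [← Finset.add_sum_erase _ _ (Finset.mem_univ 0), Finset.sum_congr rfl hne, zero_mul, zero_mul,
      map_zero, h0] at hsum
    have hsumR : (R ^ 2 - 1 : ℝ) + ∑ c ∈ (Finset.univ : Finset (ZMod p)).erase 0,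
        R * g^[j + 1] (T c) = N := by exact_mod_cast hsum
    have h1mem : (1 : ZMod p) ∈ (Finset.univ : Finset (ZMod p)).erase 0 := by simp
    rw [← Finset.mul_sum, ← Finset.add_sum_erase _ _ h1mem] at hsumR
    -- The remaining dilates may be very negative; only the upper bound 2 for each is needed against
    -- the lower bound for the count.
    have hrest : ∑ c ∈ ((Finset.univ : Finset (ZMod p)).erase 0).erase 1, g^[j + 1] (T c) ≤ 2 * p := by
      have h1 : ∑ c ∈ ((Finset.univ : Finset (ZMod p)).erase 0).erase 1, g^[j + 1] (T c) ≤
          (((Finset.univ : Finset (ZMod p)).erase 0).erase 1).card • (2 : ℝ) :=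
        Finset.sum_le_card_nsmul _ _ _ fun c _ => iterate_two_sub_sq_le_two _ _
      have h2 : (((Finset.univ : Finset (ZMod p)).erase 0).erase 1).card ≤ p := by
        have := Finset.card_le_univ (((Finset.univ : Finset (ZMod p)).erase 0).erase 1)
        rwa [ZMod.card] at this
      have h3 : ((((Finset.univ : Finset (ZMod p)).erase 0).erase 1).card : ℝ) ≤ p := by
        exact_mod_cast h2
      rw [nsmul_eq_mul] at h1
      linarith
    have hit := iterate_two_sub_sq_le hη.le hT1 j
    have hlowR : (R : ℝ) ^ 2 ≤ N + (6 * p + 2) * R + 8 * p := by exact_mod_cast hlow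
    have hRpos : (0 : ℝ) < R := by
      have : 0 < R := by omega
      exact_mod_cast this
    have hR1 : (1 : ℝ) ≤ R := by
      have : 1 ≤ R := by omega
      exact_mod_cast this
    have hfin : (R : ℝ) * (4 ^ j * η) ≤ R * (16 * p + 2) := by
      have : (R : ℝ) * (g^[j + 1] (T 1) + ∑ c ∈ ((Finset.univ : Finset (ZMod p)).erase 0).erase 1,
          g^[j + 1] (T c)) ≤ R * ((-2 - 4 ^ j * η) + 2 * p) :=
        mul_le_mul_of_nonneg_left (add_le_add hit hrest) hRpos.le
      nlinarith
    exact le_of_mul_le_mul_left hfin hRpos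
  obtain ⟨j, hj⟩ := pow_unbounded_of_one_lt ((16 * p + 2) / η) (show (1 : ℝ) < 4 by norm_num)
  have h1 := hbound (max j (4 * p + 3)) (le_max_right _ _)
  have h2 : (4 : ℝ) ^ j ≤ 4 ^ max j (4 * p + 3) :=
    pow_le_pow_right₀ (by norm_num) (le_max_left _ _)
  rw [div_lt_iff₀ hη] at hj
  nlinarith

end Weil

/-! ### Residue rings and the formula for ρ -/

lemma e_int_div (q : ℕ) [NeZero q] (j : ℤ) :
    e ((j : ℝ) / (q : ℝ)) = ZMod.stdAddChar (N := q) (j : ZMod q) := by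
  rw [ZMod.stdAddChar_coe, e]
  congr 1
  push_cast
  ring

lemma sum_range_natCast_zmod (q : ℕ) [NeZero q] (G : ZMod q → ℂ) :
    ∑ k ∈ Finset.range q, G (k : ZMod q) = ∑ x : ZMod q, G x := by
  refine Finset.sum_bij' (fun k _ => (k : ZMod q)) (fun x _ => x.val) (fun _ _ => Finset.mem_univ _)
    (fun x _ => Finset.mem_range.2 (ZMod.val_lt x)) (fun k hk => ?_) (fun x _ => ?_) fun _ _ => rfl
  · exact ZMod.val_cast_of_lt (Finset.mem_range.1 hk)
  · exact ZMod.natCast_zmod_val x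

lemma sum_range_mul_natCast_zmod (q m : ℕ) [NeZero q] (G : ZMod q → ℂ) :
    ∑ k ∈ Finset.range (q * m), G (k : ZMod q) = m * ∑ x : ZMod q, G x := by
  induction m with
  | zero => simp
  | succ m ih =>
    rw [Nat.mul_succ, Finset.sum_range_add, ih]
    have : ∀ k : ℕ, ((q * m + k : ℕ) : ZMod q) = k := fun k => by push_cast; simp
    simp only [this, sum_range_natCast_zmod]
    push_cast; ring

lemma S_eq_kl (q : ℕ) [NeZero q] (m n : ℤ) :
    S m n q = kl (ZMod.stdAddChar (N := q)) (m : ZMod q) (n : ZMod q) := by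
  rw [S, kl]
  refine Finset.sum_bij' (fun x hx => ZMod.unitOfCoprime x (Finset.mem_filter.1 hx).2)
    (fun u _ => (u : ZMod q).val) (fun _ _ => Finset.mem_univ _) (fun u _ => ?_) (fun x hx => ?_)
    (fun u _ => ?_) fun x hx => ?_
  · exact Finset.mem_filter.2 ⟨Finset.mem_range.2 (ZMod.val_lt _), ZMod.val_coe_unit_coprime u⟩
  · rw [ZMod.coe_unitOfCoprime]
    exact ZMod.val_cast_of_lt (Finset.mem_range.1 (Finset.mem_filter.1 hx).1)
  · ext
    rw [ZMod.coe_unitOfCoprime, ZMod.natCast_zmod_val]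
  · have h1 : (((ZMod.unitOfCoprime x (Finset.mem_filter.1 hx).2)⁻¹ : (ZMod q)ˣ) : ZMod q)
        = (x : ZMod q)⁻¹ := by
      rw [← ZMod.inv_coe_unit, ZMod.coe_unitOfCoprime]
    have h2 := e_int_div q (m * x + n * ((x : ZMod q)⁻¹).val)
    push_cast at h2
    rw [h2, h1, ZMod.coe_unitOfCoprime, ZMod.natCast_zmod_val]

/-- The number of solutions of `y² - n y + 1 = 0` modulo `q`. -/
lemma rho_eq_card (q : ℕ) [NeZero q] (n : ℤ) :
    rho q (n ^ 2 - 4) = (Finset.univ.filter fun y : ZMod q => y ^ 2 - n * y + 1 = 0).card := by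
  have hq : 0 < q := NeZero.pos q
  have hqz : (0 : ℤ) < 2 * q := by exact_mod_cast (show 0 < 2 * q by omega)
  have hiff : ∀ y : ℤ, ((y : ZMod q) ^ 2 - n * y + 1 = 0) ↔ (q : ℤ) ∣ y ^ 2 - n * y + 1 := by
    intro y
    rw [← ZMod.intCast_zmod_eq_zero_iff_dvd]
    push_cast; rfl
  symm
  rw [rho]
  -- The bijection is x = 2y − n: then x² − (n² − 4) = 4(y² − ny + 1), and classes y mod q match
  -- classes 2y mod 2q.
  refine Finset.card_bij (fun y _ => ((2 * (y.val : ℤ) - n) % (2 * q)).toNat) ?_ ?_ ?_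
  · intro y hy
    have hy := (Finset.mem_filter.1 hy).2
    have hy' : (q : ℤ) ∣ (y.val : ℤ) ^ 2 - n * (y.val : ℤ) + 1 := by
      rw [← hiff]; simpa using hy
    have h0 := Int.emod_nonneg (2 * (y.val : ℤ) - n) hqz.ne'
    have h1 := Int.emod_lt_of_pos (2 * (y.val : ℤ) - n) hqz
    refine Finset.mem_filter.2 ⟨Finset.mem_range.2 (by omega), ?_⟩
    rw [Int.toNat_of_nonneg h0]
    obtain ⟨t, ht⟩ : (2 * (q : ℤ)) ∣ (2 * (y.val : ℤ) - n) - (2 * (y.val : ℤ) - n) % (2 * q) :=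
      Int.dvd_self_sub_emod
    obtain ⟨s, hs⟩ := hy'
    refine (Int.modEq_iff_dvd.2 ?_)
    generalize hr : (2 * (y.val : ℤ) - n) % (2 * q) = r at *
    have hr' : r = 2 * (y.val : ℤ) - n - 2 * q * t := by linarith
    refine ⟨-s + (2 * y.val - n) * t - q * t ^ 2, ?_⟩
    rw [hr']
    linear_combination (-4 : ℤ) * hs
  · intro y _ y' _ h
    have h0 := Int.emod_nonneg (2 * (y.val : ℤ) - n) hqz.ne'
    have h0' := Int.emod_nonneg (2 * (y'.val : ℤ) - n) hqz.ne'
    have h1 : (2 * (y.val : ℤ) - n) % (2 * q) = (2 * (y'.val : ℤ) - n) % (2 * q) := by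
      omega
    have h2 : (2 * (q : ℤ)) ∣ (2 * (y'.val : ℤ) - n) - (2 * (y.val : ℤ) - n) :=
      Int.modEq_iff_dvd.1 h1
    obtain ⟨t, ht⟩ := h2
    have h3 : (y'.val : ℤ) = y.val + q * t := by linarith
    have := congrArg (Int.cast : ℤ → ZMod q) h3
    push_cast at this
    simpa using this.symm
  · intro x hx
    obtain ⟨hx1, hx2⟩ := Finset.mem_filter.1 hx
    have hx1 := Finset.mem_range.1 hx1
    obtain ⟨s, hs⟩ := Int.modEq_iff_dvd.1 hx2
    -- The congruence modulo 4q forces x and n to have equal parity, so y = (x + n)/2 exists.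
    have hpar : (2 : ℤ) ∣ x + n := by
      have h4 : (2 : ℤ) ∣ (x : ℤ) ^ 2 + n ^ 2 :=
        ⟨n ^ 2 - 2 - 2 * q * s, by linear_combination -hs⟩
      have h5 : (2 : ℤ) ∣ (x + n) ^ 2 := by
        obtain ⟨w, hw⟩ := h4
        exact ⟨w + x * n, by linear_combination hw⟩
      exact Int.prime_two.dvd_of_dvd_pow h5
    obtain ⟨y, hy⟩ := hpar
    have hxy : (x : ℤ) = 2 * y - n := by linarith
    refine ⟨(y : ZMod q), Finset.mem_filter.2 ⟨Finset.mem_univ _, ?_⟩, ?_⟩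
    · rw [hiff]
      rw [hxy] at hs
      exact ⟨-s, by linarith⟩
    · have hval : (((y : ZMod q).val : ℤ)) = y % q := ZMod.val_intCast y
      have h6 : (2 * (((y : ZMod q).val : ℤ)) - n) % (2 * q) = x := by
        rw [hval]
        have h7 : 2 * (y % (q : ℤ)) - n = x - 2 * q * (y / q) := by
          have := Int.emod_add_mul_ediv y q
          rw [hxy]; linarith
        rw [h7, Int.sub_mul_emod_self_left]
        exact Int.emod_eq_of_lt (by positivity) (by exact_mod_cast hx1)
      rw [h6, Int.toNat_natCast]

lemma card_filter_quadratic_neg (q : ℕ) [NeZero q] (n : ℤ) :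
    (Finset.univ.filter fun y : ZMod q => y ^ 2 - n * y + 1 = 0).card =
      (Finset.univ.filter fun y : ZMod q => y ^ 2 + n * y + 1 = 0).card := by
  refine Finset.card_equiv (Equiv.neg _) fun y => ?_
  simp [sub_eq_add_neg]

lemma card_filter_units_quadratic (q : ℕ) [NeZero q] (n : ℤ) :
    (Finset.univ.filter fun u : (ZMod q)ˣ => (n : ZMod q) + (u + (u⁻¹ : (ZMod q)ˣ)) = 0).card =
      (Finset.univ.filter fun y : ZMod q => y ^ 2 + n * y + 1 = 0).card := by
  refine Finset.card_bij (fun u _ => (u : ZMod q)) (fun u hu => ?_) (fun u _ v _ h => Units.ext h)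
    fun y hy => ?_
  · have hu := (Finset.mem_filter.1 hu).2
    refine Finset.mem_filter.2 ⟨Finset.mem_univ _, ?_⟩
    linear_combination u * hu - u.mul_inv
  · have hy := (Finset.mem_filter.1 hy).2
    have hinv : y * -(y + n) = 1 := by linear_combination -hy
    refine ⟨⟨y, -(y + n), hinv, by rw [mul_comm, hinv]⟩,
      Finset.mem_filter.2 ⟨Finset.mem_univ _, ?_⟩, rfl⟩
    simp only [Units.inv_mk]
    ring

theorem rho_eq_sum_S (q : ℕ) [NeZero q] (n : ℤ) :
    (rho q (n ^ 2 - 4) : ℂ) = 1 / (q : ℂ) * ∑ k ∈ Finset.range q,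
      e ((k : ℝ) * (n : ℝ) / (q : ℝ)) * S (k : ℤ) (k : ℤ) q := by
  have hq0 : (q : ℂ) ≠ 0 := Nat.cast_ne_zero.2 (NeZero.ne q)
  have h1 : ∀ k : ℕ, e ((k : ℝ) * (n : ℝ) / (q : ℝ)) * S (k : ℤ) (k : ℤ) q =
      ∑ u : (ZMod q)ˣ, ZMod.stdAddChar (N := q) ((k : ZMod q) * (n + (u + (u⁻¹ : (ZMod q)ˣ)))) := by
    intro k
    have := e_int_div q (k * n)
    push_cast at this
    rw [this, S_eq_kl, kl, Finset.mul_sum]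
    refine Finset.sum_congr rfl fun u _ => ?_
    rw [← AddChar.map_add_eq_mul]
    congr 1
    push_cast
    ring
  simp only [h1]
  rw [sum_range_natCast_zmod q (fun k => ∑ u : (ZMod q)ˣ,
    ZMod.stdAddChar (N := q) (k * (n + (u + (u⁻¹ : (ZMod q)ˣ))))), Finset.sum_comm]
  simp only [AddChar.sum_mulShift _ (ZMod.isPrimitive_stdAddChar q), ZMod.card]
  rw [rho_eq_card, card_filter_quadratic_neg, ← card_filter_units_quadratic, Finset.card_filter]
  push_cast
  rw [Finset.mul_sum]
  refine Finset.sum_congr rfl fun u _ => ?_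
  split_ifs <;> simp [hq0]

/-! ### Ramanujan sums and the formula for λ -/

/-- The Ramanujan sum. -/
noncomputable def ramanujanSum (q : ℕ) (m : ℤ) : ℂ :=
  ∑ x ∈ Finset.range q with Nat.Coprime x q, e ((x : ℝ) * m / q)

lemma ramanujanSum_eq_sum_units (q : ℕ) [NeZero q] (m : ℤ) :
    ramanujanSum q m = ∑ u : (ZMod q)ˣ, ZMod.stdAddChar (N := q) (u * (m : ZMod q)) := by
  have h := S_eq_kl q m 0
  have h1 : S m 0 q = ramanujanSum q m := by
    rw [S, ramanujanSum]
    exact Finset.sum_congr rfl fun x _ => by push_cast; congr 1; ring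
  rw [← h1, h, kl]
  exact Finset.sum_congr rfl fun x _ => by push_cast; congr 1; ring

/-- Sorting the fractions k/q by their reduced denominator d turns the divisor sum into a full
character sum modulo q. -/
lemma sum_divisors_ramanujanSum (q : ℕ) [NeZero q] (m : ℤ) :
    ∑ d ∈ q.divisors, ramanujanSum d m = if (m : ZMod q) = 0 then (q : ℂ) else 0 := by
  have hq : 0 < q := NeZero.pos q
  have h1 : ∑ k ∈ Finset.range q, e ((k : ℝ) * m / q) = if (m : ZMod q) = 0 then (q : ℂ) else 0 := by
    have h2 : ∀ k : ℕ, e ((k : ℝ) * m / q) = ZMod.stdAddChar (N := q) ((k : ZMod q) * m) := by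
      intro k
      have := e_int_div q (k * m)
      push_cast at this
      exact this
    simp only [h2]
    rw [sum_range_natCast_zmod q fun k => ZMod.stdAddChar (N := q) (k * m),
      AddChar.sum_mulShift _ (ZMod.isPrimitive_stdAddChar q), ZMod.card]
    split_ifs <;> simp
  rw [← h1]
  simp only [ramanujanSum]
  rw [Finset.sum_sigma']
  refine Finset.sum_bij' (fun s _ => s.2 * (q / s.1)) (fun x _ => ⟨q / q.gcd x, x / q.gcd x⟩)
    ?_ ?_ ?_ ?_ ?_
  · rintro ⟨d, y⟩ h
    simp only [Finset.mem_sigma, Nat.mem_divisors, Finset.mem_filter, Finset.mem_range] at h ⊢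
    obtain ⟨⟨hd, -⟩, hy, -⟩ := h
    calc y * (q / d) < d * (q / d) := Nat.mul_lt_mul_of_pos_right hy (Nat.div_pos (Nat.le_of_dvd hq hd) (by omega))
      _ = q := Nat.mul_div_cancel' hd
  · intro x hx
    have hx := Finset.mem_range.1 hx
    have hg : 0 < q.gcd x := Nat.gcd_pos_of_pos_left _ hq
    simp only [Finset.mem_sigma, Nat.mem_divisors, Finset.mem_filter, Finset.mem_range]
    refine ⟨⟨Nat.div_dvd_of_dvd (Nat.gcd_dvd_left _ _), hq.ne'⟩, ?_, ?_⟩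
    · exact Nat.div_lt_div_of_lt_of_dvd (Nat.gcd_dvd_left _ _) hx
    · exact (Nat.coprime_div_gcd_div_gcd hg).symm
  · rintro ⟨d, y⟩ h
    simp only [Finset.mem_sigma, Nat.mem_divisors, Finset.mem_filter, Finset.mem_range] at h ⊢
    obtain ⟨⟨⟨c, rfl⟩, -⟩, hy, hco⟩ := h
    have hd : 0 < d := by omega
    have hc : 0 < c := Nat.pos_of_mul_pos_left hq
    rw [Nat.mul_div_cancel_left _ hd, Nat.gcd_mul_right, Nat.Coprime.gcd_eq_one hco.symm, one_mul,
      Nat.mul_div_cancel _ hc, Nat.mul_div_cancel _ hc]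
  · intro x hx
    have hg : 0 < q.gcd x := Nat.gcd_pos_of_pos_left _ hq
    dsimp only
    rw [Nat.div_div_self (Nat.gcd_dvd_left _ _) hq.ne', Nat.div_mul_cancel (Nat.gcd_dvd_right _ _)]
  · rintro ⟨d, y⟩ h
    simp only [Finset.mem_sigma, Nat.mem_divisors, Finset.mem_filter, Finset.mem_range] at h ⊢
    obtain ⟨⟨⟨c, rfl⟩, -⟩, hy, hco⟩ := h
    have hd : 0 < d := by omega
    have hc : 0 < c := Nat.pos_of_mul_pos_left hq
    rw [Nat.mul_div_cancel_left _ hd]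
    congr 1
    have hd' : (d : ℝ) ≠ 0 := by positivity
    have hc' : (c : ℝ) ≠ 0 := by positivity
    push_cast
    field_simp

/-- The normalised twisted sum of Kloosterman sums `S(k², 1; q)`. -/
noncomputable def klAverage (n : ℤ) (q : ℕ) : ℂ :=
  1 / (q : ℂ) * ∑ k ∈ Finset.range q, e ((k : ℝ) * (n : ℝ) / (q : ℝ)) * S ((k : ℤ) ^ 2) 1 q

lemma klAverage_eq (n : ℤ) (q : ℕ) [NeZero q] :
    klAverage n q = 1 / (q : ℂ) * ∑ k : ZMod q,
      ZMod.stdAddChar (N := q) (k * n) * kl (ZMod.stdAddChar (N := q)) (k ^ 2) 1 := by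
  rw [klAverage, ← sum_range_natCast_zmod q fun k =>
    ZMod.stdAddChar (N := q) (k * n) * kl (ZMod.stdAddChar (N := q)) (k ^ 2) 1]
  congr 1
  refine Finset.sum_congr rfl fun k _ => ?_
  have := e_int_div q (k * n)
  push_cast at this
  rw [this, S_eq_kl]
  push_cast
  rfl

/-- Replace k by ku after inverting u; the phase k²u + u⁻¹ + kn then becomes u⁻¹ times a quadratic
polynomial in ku. -/
lemma klAverage_eq_ramanujanSum (n : ℤ) (q : ℕ) [NeZero q] :
    klAverage n q = 1 / (q : ℂ) * ∑ k : ZMod q, ∑ u : (ZMod q)ˣ,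
      ZMod.stdAddChar (N := q) (u * (k ^ 2 + n * k + 1)) := by
  rw [klAverage_eq]
  congr 1
  simp only [kl, Finset.mul_sum]
  rw [Finset.sum_comm]
  conv_rhs => rw [Finset.sum_comm, ← Equiv.sum_comp (Equiv.inv (ZMod q)ˣ)]
  refine Finset.sum_congr rfl fun u _ => ?_
  rw [← Equiv.sum_comp (Units.mulRight u) (fun k : ZMod q => ZMod.stdAddChar (N := q)
    (((Equiv.inv (ZMod q)ˣ) u : (ZMod q)ˣ) * (k ^ 2 + n * k + 1)))]
  refine Finset.sum_congr rfl fun k _ => ?_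
  rw [← AddChar.map_add_eq_mul]
  congr 1
  simp only [Units.mulRight_apply, Equiv.inv_apply]
  linear_combination (-(k ^ 2 * u) - n * k) * u.inv_mul

/-- Each average modulo d can be taken over a full period modulo q, after which the Ramanujan sums
combine to detect roots modulo q. -/
lemma sum_divisors_klAverage (n : ℤ) (q : ℕ) (hq : 0 < q) :
    ∑ d ∈ q.divisors, klAverage n d = rho q (n ^ 2 - 4) := by
  have : NeZero q := ⟨hq.ne'⟩
  have hq0 : (q : ℂ) ≠ 0 := Nat.cast_ne_zero.2 hq.ne'
  apply mul_left_cancel₀ hq0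
  have h1 : ∀ d ∈ q.divisors, (q : ℂ) * klAverage n d =
      ∑ k ∈ Finset.range q, ramanujanSum d ((k : ℤ) ^ 2 + n * k + 1) := by
    intro d hd
    obtain ⟨⟨c, hc⟩, -⟩ := Nat.mem_divisors.1 hd
    have : NeZero d := ⟨by rintro rfl; omega⟩
    have hd0 : (d : ℂ) ≠ 0 := Nat.cast_ne_zero.2 (NeZero.ne d)
    rw [hc, klAverage_eq_ramanujanSum]
    simp only [ramanujanSum_eq_sum_units]
    push_cast
    rw [sum_range_mul_natCast_zmod d c fun k => ∑ u : (ZMod d)ˣ,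
      ZMod.stdAddChar (N := d) (u * (k ^ 2 + n * k + 1))]
    field_simp
  rw [Finset.mul_sum, Finset.sum_congr rfl h1, Finset.sum_comm]
  simp only [sum_divisors_ramanujanSum]
  push_cast
  rw [sum_range_natCast_zmod q fun k => if k ^ 2 + n * k + 1 = 0 then (q : ℂ) else 0, rho_eq_card,
    card_filter_quadratic_neg, Finset.card_filter]
  push_cast
  rw [Finset.mul_sum]
  exact Finset.sum_congr rfl fun k _ => by split_ifs <;> simp

theorem lam_eq_sum_klAverage (q : ℕ) (hq : 0 < q) (n : ℤ) :
    (lam q (n ^ 2 - 4) : ℂ) =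
      ∑ t ∈ q.divisors ×ˢ q.divisors with t.1 ^ 2 * t.2 = q, klAverage n t.2 := by
  have hinv := (ArithmeticFunction.sum_eq_iff_sum_mul_moebius_eq (R := ℂ) (f := klAverage n)
    (g := fun q => (rho q (n ^ 2 - 4) : ℂ))).1 (fun q hq => sum_divisors_klAverage n q hq)
  have h1 : ∀ t ∈ (q.divisors ×ˢ q.divisors).filter (fun t => t.1 ^ 2 * t.2 = q),
      klAverage n t.2 = ∑ x ∈ t.2.divisorsAntidiagonal,
        ((ArithmeticFunction.moebius x.1 : ℤ) : ℂ) * (rho x.2 (n ^ 2 - 4) : ℂ) := by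
    intro t ht
    have h2 := (Finset.mem_product.1 (Finset.mem_filter.1 ht).1).2
    exact (hinv t.2 (Nat.pos_of_mem_divisors h2)).symm
  rw [Finset.sum_congr rfl h1, Finset.sum_sigma', lam]
  push_cast
  refine Finset.sum_bij' (fun t _ => ⟨(t.1, t.2.1 * t.2.2), (t.2.1, t.2.2)⟩)
    (fun s _ => (s.1.1, s.2.1, s.2.2)) ?_ ?_ ?_ ?_ ?_
  · rintro ⟨a, b, c⟩ h
    simp only [Finset.mem_filter, Finset.mem_product, Nat.mem_divisors] at h
    obtain ⟨⟨⟨ha, -⟩, -⟩, h⟩ := h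
    simp only [Finset.mem_sigma, Finset.mem_filter, Finset.mem_product, Nat.mem_divisors,
      Nat.mem_divisorsAntidiagonal]
    refine ⟨⟨⟨⟨ha, hq.ne'⟩, ⟨⟨a ^ 2, by rw [← h]; ring⟩, hq.ne'⟩⟩, by rw [← h]; ring⟩, trivial, ?_⟩
    rintro h0
    rw [mul_assoc, h0, mul_zero] at h
    omega
  · rintro ⟨⟨a, b⟩, ⟨c, d⟩⟩ h
    simp only [Finset.mem_sigma, Finset.mem_filter, Finset.mem_product, Nat.mem_divisors,
      Nat.mem_divisorsAntidiagonal] at h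
    obtain ⟨⟨⟨⟨ha, -⟩, hb, -⟩, h⟩, rfl, -⟩ := h
    simp only [Finset.mem_filter, Finset.mem_product, Nat.mem_divisors]
    exact ⟨⟨⟨ha, hq.ne'⟩, ⟨(Dvd.intro _ rfl).trans hb, hq.ne'⟩, (Dvd.intro_left _ rfl).trans hb,
      hq.ne'⟩, by rw [← h]; ring⟩
  · rintro ⟨a, b, c⟩ _; rfl
  · rintro ⟨⟨a, b⟩, ⟨c, d⟩⟩ h
    simp only [Finset.mem_sigma, Nat.mem_divisorsAntidiagonal] at h
    obtain ⟨-, rfl, -⟩ := h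
    rfl
  · rintro ⟨a, b, c⟩ _; rfl

/-- This is the Ramanujan sum c_q(1); its divisor sums are the indicator of q = 1, and Möbius
inversion applies. -/
lemma kl_zero_one_eq_moebius (q : ℕ) [NeZero q] :
    kl (ZMod.stdAddChar (N := q)) 0 1 = (ArithmeticFunction.moebius q : ℂ) := by
  have h0 : kl (ZMod.stdAddChar (N := q)) 0 1 = ramanujanSum q 1 := by
    rw [ramanujanSum_eq_sum_units, kl, ← Equiv.sum_comp (Equiv.inv (ZMod q)ˣ)]
    refine Finset.sum_congr rfl fun u _ => ?_
    simp
  rw [h0]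
  have hinv := (ArithmeticFunction.sum_eq_iff_sum_mul_moebius_eq (R := ℂ)
    (f := fun d => ramanujanSum d 1) (g := fun q => if q = 1 then 1 else 0)).1 (fun q hq => by
      have : NeZero q := ⟨hq.ne'⟩
      rw [sum_divisors_ramanujanSum q 1]
      by_cases h1 : q = 1
      · subst h1
        rw [if_pos (Subsingleton.elim _ _)]; simp
      · have : Fact (1 < q) := ⟨by omega⟩
        simp [h1])
  rw [← hinv q (NeZero.pos q), Finset.sum_eq_single (q, 1)]
  · simp
  · rintro ⟨a, b⟩ h hne
    have h := (Nat.mem_divisorsAntidiagonal.1 h).1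
    have : b ≠ 1 := by
      rintro rfl
      exact hne (by rw [← h]; simp)
    simp [this]
  · intro h
    exact absurd (Nat.mem_divisorsAntidiagonal.2 ⟨mul_one q, NeZero.ne q⟩) h

lemma mul_sub_inv_eq_zero_iff {R : Type*} [CommRing R] (a c : R) (u : Rˣ) :
    c * (a * u - (u⁻¹ : Rˣ)) = 0 ↔ c * (a * u ^ 2 - 1) = 0 := by
  constructor
  · intro h
    linear_combination u * h + c * u.mul_inv
  · intro h
    linear_combination (u⁻¹ : Rˣ) * h - c * a * u * u.mul_inv

/-! ### Stationary phase over finite rings -/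

section FiniteRing

variable {R : Type*} [CommRing R] [Fintype R] [DecidableEq R]

/-- Averaging over the substitutions `u ↦ u (1 + π t)`. -/
lemma card_mul_kl {ψ : AddChar R ℂ} (a π : R) (hπ : π ^ 3 = 0) :
    (Fintype.card R : ℂ) * kl ψ a 1 = ∑ u : Rˣ, ψ (a * u + (u⁻¹ : Rˣ)) *
      ∑ t : R, ψ (π ^ 2 * (u⁻¹ : Rˣ) * t ^ 2 + π * (a * u - (u⁻¹ : Rˣ)) * t) := by
  -- (1 + x)(1 − x + x²) = 1 + x³, and π³ = 0.
  have hunit : ∀ t : R, (1 + π * t) * (1 - π * t + π ^ 2 * t ^ 2) = 1 := fun t => by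
    linear_combination t ^ 3 * hπ
  let v : R → Rˣ := fun t => ⟨1 + π * t, 1 - π * t + π ^ 2 * t ^ 2, hunit t,
    by rw [mul_comm, hunit]⟩
  have h1 : ∀ t : R, kl ψ a 1 = ∑ u : Rˣ, ψ (a * u + (u⁻¹ : Rˣ)) *
      ψ (π ^ 2 * (u⁻¹ : Rˣ) * t ^ 2 + π * (a * u - (u⁻¹ : Rˣ)) * t) := by
    intro t
    rw [kl, ← Equiv.sum_comp (Equiv.mulRight (v t))]
    refine Finset.sum_congr rfl fun u _ => ?_
    rw [← AddChar.map_add_eq_mul]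
    congr 1
    simp only [Equiv.coe_mulRight, mul_inv_rev, Units.val_mul, v, Units.inv_mk]
    ring
  have h2 : (Fintype.card R : ℂ) * kl ψ a 1 = ∑ t : R, kl ψ a 1 := by
    rw [Finset.sum_const, Finset.card_univ, nsmul_eq_mul]
  rw [h2, Finset.sum_congr rfl fun t _ => h1 t, Finset.sum_comm]
  simp only [Finset.mul_sum]

/-- When π² = 0 the inner sum over t is linear, so only the stationary points π(au² − 1) = 0
survive. -/
lemma norm_kl_le_card {ψ : AddChar R ℂ} (hψ : ψ.IsPrimitive) (a π : R) (hπ : π ^ 2 = 0) :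
    ‖kl ψ a 1‖ ≤ (Finset.univ.filter fun u : Rˣ => π * (a * u ^ 2 - 1) = 0).card := by
  have hq : (0 : ℝ) < Fintype.card R := by exact_mod_cast Fintype.card_pos
  have h := card_mul_kl (ψ := ψ) a π (by rw [pow_succ, hπ, zero_mul])
  have h1 : ∀ u : Rˣ, ∑ t : R, ψ (π ^ 2 * (u⁻¹ : Rˣ) * t ^ 2 + π * (a * u - (u⁻¹ : Rˣ)) * t) =
      if π * (a * u ^ 2 - 1) = 0 then (Fintype.card R : ℂ) else 0 := by
    intro u
    have : ∀ t : R, π ^ 2 * (u⁻¹ : Rˣ) * t ^ 2 + π * (a * u - (u⁻¹ : Rˣ)) * t =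
        t * (π * (a * u - (u⁻¹ : Rˣ))) := fun t => by rw [hπ]; ring
    simp only [this, AddChar.sum_mulShift _ hψ, mul_sub_inv_eq_zero_iff]
    split_ifs <;> simp
  simp only [h1] at h
  have h2 := congrArg norm h
  rw [norm_mul, Complex.norm_natCast] at h2
  refine le_of_mul_le_mul_left ?_ hq
  rw [h2, Finset.card_filter, Nat.cast_sum, Finset.mul_sum]
  refine norm_sum_le_of_le _ fun u _ => ?_
  rw [norm_mul, AddChar.norm_apply, one_mul]
  split_ifs <;> simp

/-- Shifting t by s makes the phase difference linear in s; summing over s forces 2Ah = 0. -/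
lemma norm_sq_sum_quadratic {ψ : AddChar R ℂ} (hψ : ψ.IsPrimitive) (h2 : IsUnit (2 : R)) (A B : R) :
    ((‖∑ t : R, ψ (A * t ^ 2 + B * t)‖ ^ 2 : ℝ) : ℂ) =
      Fintype.card R * ∑ h ∈ Finset.univ.filter (fun h : R => A * h = 0), ψ (B * h) := by
  rw [Complex.ofReal_pow, ← Complex.mul_conj', map_sum, Finset.sum_mul_sum, Finset.sum_comm]
  have h1 : ∀ s : R, ∑ t : R, ψ (A * t ^ 2 + B * t) * (starRingEnd ℂ) (ψ (A * s ^ 2 + B * s)) =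
      ∑ h : R, ψ (A * h ^ 2 + B * h) * ψ (s * (2 * (A * h))) := by
    intro s
    rw [← Equiv.sum_comp (Equiv.addRight s)]
    refine Finset.sum_congr rfl fun t _ => ?_
    rw [← AddChar.map_neg_eq_conj, ← AddChar.map_add_eq_mul, ← AddChar.map_add_eq_mul]
    congr 1
    simp only [Equiv.coe_addRight]
    ring
  rw [Finset.sum_congr rfl fun s _ => h1 s, Finset.sum_comm, Finset.sum_filter, Finset.mul_sum]
  refine Finset.sum_congr rfl fun h _ => ?_
  rw [← Finset.mul_sum, AddChar.sum_mulShift _ hψ]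
  simp only [h2.mul_right_eq_zero]
  split_ifs with h0
  · have : A * h ^ 2 + B * h = B * h := by rw [sq, ← mul_assoc, h0]; ring
    rw [this, mul_comm]
  · simp

lemma sum_filter_mul_eq_zero {ψ : AddChar R ℂ} (A B : R) (h0 : R) (hA : A * h0 = 0)
    (hB : ψ (B * h0) ≠ 1) : ∑ h ∈ Finset.univ.filter (fun h : R => A * h = 0), ψ (B * h) = 0 := by
  rw [Finset.sum_filter]
  refine eq_zero_of_mul_eq_self_left hB ?_
  conv_rhs => rw [← Equiv.sum_comp (Equiv.addRight h0)]
  rw [Finset.mul_sum]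
  refine Finset.sum_congr rfl fun h _ => ?_
  simp only [Equiv.coe_addRight, mul_add, hA, add_zero, AddChar.map_add_eq_mul]
  split_ifs
  · ring
  · simp

/-- The inner sums are now quadratic Gauss sums. Off the stationary set the linear character is
nontrivial on the multiples of ϖ, which annihilate π², and the Gauss sum vanishes; on it the
annihilator of π² bounds it by |R|/√m. For odd prime-power exponents this gains the √p lost by
rounding the exponent up. -/
lemma norm_kl_le_card_div_sqrt {ψ : AddChar R ℂ} (hψ : ψ.IsPrimitive) (h2 : IsUnit (2 : R))
    (a π ϖ : R) (hπ : π ^ 3 = 0) (hϖ : π ^ 2 * ϖ = 0) (m : ℝ) (hm : 0 ≤ m)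
    (hcard : ((Finset.univ.filter fun h : R => π ^ 2 * h = 0).card : ℝ) * m ≤ Fintype.card R) :
    ‖kl ψ a 1‖ * √m ≤ (Finset.univ.filter fun u : Rˣ => (π * ϖ) * (a * u ^ 2 - 1) = 0).card := by
  have hq : (0 : ℝ) < Fintype.card R := by exact_mod_cast Fintype.card_pos
  have h := congrArg norm (card_mul_kl (ψ := ψ) a π hπ)
  rw [norm_mul, Complex.norm_natCast] at h
  refine le_of_mul_le_mul_left ?_ hq
  rw [← mul_assoc, h, Finset.card_filter, Nat.cast_sum, Finset.mul_sum]
  refine (mul_le_mul_of_nonneg_right (norm_sum_le _ _) (Real.sqrt_nonneg m)).trans ?_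
  rw [Finset.sum_mul]
  refine Finset.sum_le_sum fun u _ => ?_
  rw [norm_mul, AddChar.norm_apply, one_mul]
  have hG := norm_sq_sum_quadratic hψ h2 (π ^ 2 * (u⁻¹ : Rˣ)) (π * (a * u - (u⁻¹ : Rˣ)))
  have hiff : ∀ h : R, π ^ 2 * (u⁻¹ : Rˣ) * h = 0 ↔ π ^ 2 * h = 0 := fun h => by
    rw [mul_right_comm, Units.mul_left_eq_zero]
  simp only [hiff] at hG
  set G := ∑ t : R, ψ (π ^ 2 * (u⁻¹ : Rˣ) * t ^ 2 + π * (a * u - (u⁻¹ : Rˣ)) * t)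
  by_cases hu : (π * ϖ) * (a * u ^ 2 - 1) = 0
  · rw [if_pos hu, Nat.cast_one, mul_one]
    have h3 : ‖G‖ ^ 2 ≤ Fintype.card R * (Finset.univ.filter fun h : R => π ^ 2 * h = 0).card := by
      have h4 := congrArg norm hG
      rw [Complex.norm_real, Real.norm_of_nonneg (by positivity), norm_mul, Complex.norm_natCast] at h4
      rw [h4]
      refine mul_le_mul_of_nonneg_left ?_ hq.le
      refine (norm_sum_le _ _).trans (le_of_eq ?_)
      simp only [AddChar.norm_apply]
      simp
    refine abs_le_of_sq_le_sq' ?_ hq.le |>.2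
    rw [mul_pow, Real.sq_sqrt hm]
    calc ‖G‖ ^ 2 * m ≤ (Fintype.card R * (Finset.univ.filter fun h : R => π ^ 2 * h = 0).card) * m :=
          mul_le_mul_of_nonneg_right h3 hm
      _ = Fintype.card R * (((Finset.univ.filter fun h : R => π ^ 2 * h = 0).card : ℝ) * m) := by ring
      _ ≤ Fintype.card R * Fintype.card R := mul_le_mul_of_nonneg_left hcard hq.le
      _ = _ := by ring
  · have hne : π * (a * u - (u⁻¹ : Rˣ)) * ϖ ≠ 0 := by
      rw [mul_right_comm]
      rwa [Ne, mul_sub_inv_eq_zero_iff]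
    obtain ⟨k, hk⟩ := AddChar.ne_one_iff.1 (hψ hne)
    rw [AddChar.mulShift_apply, mul_assoc] at hk
    have hz := sum_filter_mul_eq_zero (ψ := ψ) (π ^ 2) (π * (a * u - (u⁻¹ : Rˣ))) (ϖ * k)
      (by rw [← mul_assoc, hϖ, zero_mul]) hk
    rw [hz, mul_zero] at hG
    have : ‖G‖ = 0 := by
      have : ‖G‖ ^ 2 = 0 := by exact_mod_cast hG
      exact pow_eq_zero_iff (two_ne_zero) |>.1 this
    rw [this, zero_mul]
    positivity

/-- Dividing by one fixed solution reduces to a = 1. -/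
lemma card_units_mul_sq_sub_one_le (a c : R) :
    (Finset.univ.filter fun u : Rˣ => c * (a * u ^ 2 - 1) = 0).card ≤
      (Finset.univ.filter fun v : Rˣ => c * ((v : R) ^ 2 - 1) = 0).card := by
  rcases Finset.eq_empty_or_nonempty (Finset.univ.filter fun u : Rˣ => c * (a * u ^ 2 - 1) = 0) with
    h | ⟨u₀, h₀⟩
  · rw [h]; simp
  have h₀ := (Finset.mem_filter.1 h₀).2
  refine Finset.card_le_card_of_injOn (fun u => u * u₀⁻¹) (fun u hu => ?_)
    fun u _ v _ h => mul_right_cancel h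
  have hu := (Finset.mem_filter.1 hu).2
  refine Finset.mem_coe.2 (Finset.mem_filter.2 ⟨Finset.mem_univ _, ?_⟩)
  have e : (u₀ : R) * (u₀⁻¹ : Rˣ) = 1 := u₀.mul_inv
  have e2 : (u₀ : R) ^ 2 * (u₀⁻¹ : Rˣ) ^ 2 = 1 := by rw [← mul_pow, e, one_pow]
  rw [Units.val_mul, mul_pow]
  linear_combination (-(u : R) ^ 2 * (u₀⁻¹ : Rˣ) ^ 2) * h₀ + (u₀ : R) ^ 2 * (u₀⁻¹ : Rˣ) ^ 2 * hu + c * e2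

end FiniteRing

/-! ### Prime power moduli -/

section PrimePower

variable {p : ℕ} [Fact p.Prime]

lemma zmod_prime_pow_isUnit_or (α : ℕ) (x : ZMod (p ^ α)) : IsUnit x ∨ ∃ y, x = p * y := by
  have hp : p.Prime := Fact.out
  have : NeZero (p ^ α) := ⟨pow_ne_zero _ hp.ne_zero⟩
  by_cases h : p ∣ x.val
  · obtain ⟨k, hk⟩ := h
    right
    refine ⟨k, ?_⟩
    rw [← Nat.cast_mul, ← hk, ZMod.natCast_zmod_val]
  · left
    rw [← ZMod.natCast_zmod_val x]
    exact (ZMod.isUnit_iff_coprime _ _).2 (Nat.Coprime.pow_right _ ((hp.coprime_iff_not_dvd.2 h).symm))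

lemma zmod_prime_pow_not_isUnit_mul {α : ℕ} (hα : 0 < α) (y : ZMod (p ^ α)) :
    ¬ IsUnit ((p : ZMod (p ^ α)) * y) := by
  have hp : p.Prime := Fact.out
  have : Fact (1 < p ^ α) := ⟨Nat.one_lt_pow hα.ne' hp.one_lt⟩
  intro h
  have h2 : ((p : ZMod (p ^ α)) * y) ^ α = 0 := by
    rw [mul_pow, ← Nat.cast_pow, ZMod.natCast_self, zero_mul]
  exact not_isUnit_zero (h2 ▸ h.pow α)

lemma card_filter_natCast_mul_eq_zero_le (n m : ℕ) [NeZero n] (hm : 0 < m) :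
    (Finset.univ.filter fun x : ZMod n => (m : ZMod n) * x = 0).card ≤ m := by
  have := IsAddCyclic.card_nsmul_eq_zero_le (α := ZMod n) hm
  simpa [nsmul_eq_mul] using this

lemma card_filter_natCast_mul_sub_eq_zero_le (n m : ℕ) [NeZero n] (hm : 0 < m) (c : ZMod n) :
    (Finset.univ.filter fun v : (ZMod n)ˣ => (m : ZMod n) * (v - c) = 0).card ≤ m := by
  refine le_trans ?_ (card_filter_natCast_mul_eq_zero_le n m hm)
  refine Finset.card_le_card_of_injOn (fun v => (v : ZMod n) - c) (fun v hv => ?_)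
    fun u _ v _ h => Units.ext (sub_left_injective h)
  exact Finset.mem_coe.2 (Finset.mem_filter.2 ⟨Finset.mem_univ _, (Finset.mem_filter.1 hv).2⟩)

lemma isUnit_two_zmod_prime_pow (hp2 : p ≠ 2) (α : ℕ) : IsUnit (2 : ZMod (p ^ α)) := by
  have hp : p.Prime := Fact.out
  have : ((2 : ℕ) : ZMod (p ^ α)) = 2 := by norm_num
  rw [← this, ZMod.isUnit_iff_coprime]
  exact Nat.Coprime.pow_right _ ((Nat.coprime_primes Nat.prime_two hp).2 hp2.symm)

/-- For odd p, v − 1 and v + 1 are not both divisible by p, so one is a unit and cancels. -/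
lemma card_sq_eq_one_odd_le (hp2 : p ≠ 2) {α : ℕ} (hα : 0 < α) [NeZero (p ^ α)] (γ : ℕ) :
    (Finset.univ.filter fun v : (ZMod (p ^ α))ˣ =>
      ((p ^ γ : ℕ) : ZMod (p ^ α)) * ((v : ZMod (p ^ α)) ^ 2 - 1) = 0).card ≤ 2 * p ^ γ := by
  have hp : p.Prime := Fact.out
  have hpos : 0 < p ^ γ := pow_pos hp.pos _
  rw [two_mul]
  refine le_trans ?_ (add_le_add (card_filter_natCast_mul_sub_eq_zero_le (p ^ α) _ hpos 1)
    (card_filter_natCast_mul_sub_eq_zero_le (p ^ α) _ hpos (-1)))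
  refine le_trans (Finset.card_le_card fun v hv => ?_) (Finset.card_union_le _ _)
  have hv := (Finset.mem_filter.1 hv).2
  rw [Finset.mem_union, Finset.mem_filter, Finset.mem_filter]
  simp only [Finset.mem_univ, true_and]
  rcases zmod_prime_pow_isUnit_or α ((v : ZMod (p ^ α)) - 1) with h | ⟨y, hy⟩
  · right
    rw [← h.mul_left_eq_zero, ← hv]
    ring
  rcases zmod_prime_pow_isUnit_or α ((v : ZMod (p ^ α)) - -1) with h | ⟨z, hz⟩
  · left
    rw [← h.mul_left_eq_zero, ← hv]
    ring
  · exfalso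
    have h2 : (2 : ZMod (p ^ α)) = p * (z - y) := by linear_combination hz - hy
    exact zmod_prime_pow_not_isUnit_mul hα _ (h2 ▸ isUnit_two_zmod_prime_pow hp2 α)

/-- Here v = 2y + 1 and v² − 1 = 4y(y + 1), where y or y + 1 is a unit; the extra 2 raises the
exponent to γ + 1. -/
lemma card_sq_eq_one_two_le {α : ℕ} (hα : 0 < α) (γ : ℕ) :
    (Finset.univ.filter fun v : (ZMod (2 ^ α))ˣ =>
      ((2 ^ γ : ℕ) : ZMod (2 ^ α)) * ((v : ZMod (2 ^ α)) ^ 2 - 1) = 0).card ≤ 4 * 2 ^ γ := by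
  have hpos : 0 < 2 ^ (γ + 1) := by positivity
  rw [show 4 * 2 ^ γ = 2 ^ (γ + 1) + 2 ^ (γ + 1) by ring]
  refine le_trans ?_ (add_le_add (card_filter_natCast_mul_sub_eq_zero_le (2 ^ α) _ hpos 1)
    (card_filter_natCast_mul_sub_eq_zero_le (2 ^ α) _ hpos (-1)))
  refine le_trans (Finset.card_le_card fun v hv => ?_) (Finset.card_union_le _ _)
  have hv := (Finset.mem_filter.1 hv).2
  rw [Finset.mem_union, Finset.mem_filter, Finset.mem_filter]
  simp only [Finset.mem_univ, true_and]
  have key : ∀ y : ZMod (2 ^ α), ¬ IsUnit (2 * y) := fun y => by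
    have := zmod_prime_pow_not_isUnit_mul (p := 2) hα y
    simpa using this
  have key2 : ∀ y : ZMod (2 ^ α), IsUnit y ∨ ∃ z, y = 2 * z := fun y => by
    have := zmod_prime_pow_isUnit_or (p := 2) α y
    simpa using this
  obtain ⟨y, hy⟩ : ∃ y : ZMod (2 ^ α), (v : ZMod (2 ^ α)) = 2 * y + 1 := by
    rcases Nat.even_or_odd' (v : ZMod (2 ^ α)).val with ⟨k, hk | hk⟩
    · exfalso
      have := congrArg (Nat.cast : ℕ → ZMod (2 ^ α)) hk
      rw [ZMod.natCast_zmod_val] at this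
      push_cast at this
      exact key k (this ▸ v.isUnit)
    · refine ⟨k, ?_⟩
      have := congrArg (Nat.cast : ℕ → ZMod (2 ^ α)) hk
      rw [ZMod.natCast_zmod_val] at this
      push_cast at this
      exact this
  rw [hy] at hv ⊢
  push_cast at hv ⊢
  rcases key2 y with h | ⟨z, hz⟩
  · right
    rw [← h.mul_left_eq_zero, ← hv]
    ring
  rcases key2 (y + 1) with h | ⟨w, hw⟩
  · left
    rw [← h.mul_left_eq_zero, ← hv]
    ring
  · exfalso
    have : (1 : ZMod (2 ^ α)) = 2 * (w - z) := by linear_combination hw - hz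
    exact key (w - z) (this ▸ isUnit_one)

lemma norm_kl_prime_pow_odd_le (hp2 : p ≠ 2) {α : ℕ} (hα : 2 ≤ α) [NeZero (p ^ α)]
    {ψ : AddChar (ZMod (p ^ α)) ℂ} (hψ : ψ.IsPrimitive) (a : ZMod (p ^ α)) :
    ‖kl ψ a 1‖ ≤ 2 * √(p ^ α : ℝ) := by
  have hp : p.Prime := Fact.out
  have hp0 : (0 : ℝ) < p := by exact_mod_cast hp.pos
  rcases Nat.even_or_odd' α with ⟨β, hβ | hβ⟩
  · have hπ : ((p ^ β : ℕ) : ZMod (p ^ α)) ^ 2 = 0 := by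
      rw [← Nat.cast_pow, ← pow_mul, mul_comm, ← hβ, ZMod.natCast_self]
    have h1 := (norm_kl_le_card hψ a _ hπ).trans (Nat.cast_le.2 ((card_units_mul_sq_sub_one_le _ _).trans
      (card_sq_eq_one_odd_le hp2 (by omega) β)))
    have h2 : √((p : ℝ) ^ α) = p ^ β := by
      rw [hβ, mul_comm, pow_mul, Real.sqrt_sq (by positivity)]
    rw [h2]
    exact_mod_cast h1
  · have hc : ∀ k, α ≤ k → ((p ^ k : ℕ) : ZMod (p ^ α)) = 0 := fun k hk =>
      (ZMod.natCast_eq_zero_iff _ _).2 (pow_dvd_pow p hk)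
    have hπ : ((p ^ β : ℕ) : ZMod (p ^ α)) ^ 3 = 0 := by
      rw [← Nat.cast_pow, ← pow_mul]; exact hc _ (by omega)
    have hϖ : ((p ^ β : ℕ) : ZMod (p ^ α)) ^ 2 * (p : ℕ) = 0 := by
      rw [← Nat.cast_pow, ← Nat.cast_mul, ← pow_mul, ← pow_succ]; exact hc _ (by omega)
    have hcard : ((Finset.univ.filter fun h : ZMod (p ^ α) =>
        ((p ^ β : ℕ) : ZMod (p ^ α)) ^ 2 * h = 0).card : ℝ) * p ≤ Fintype.card (ZMod (p ^ α)) := by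
      rw [← Nat.cast_pow, ZMod.card]
      have := card_filter_natCast_mul_eq_zero_le (p ^ α) ((p ^ β) ^ 2) (pow_pos (pow_pos hp.pos _) _)
      have h3 := Nat.mul_le_mul_right p this
      have h4 : (p ^ β) ^ 2 * p = p ^ α := by rw [hβ]; ring
      rw [h4] at h3
      exact_mod_cast h3
    -- Here α = 2β + 1, with π = p^β, ϖ = p and m = p; π³ = 0 uses β ≥ 1, which is why α = 1 needs
    -- Weil's bound.
    have h1 := norm_kl_le_card_div_sqrt hψ (isUnit_two_zmod_prime_pow hp2 α) a _ _ hπ hϖ p hp0.le hcard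
    rw [← Nat.cast_mul, ← pow_succ] at h1
    have h2 := h1.trans (Nat.cast_le.2 ((card_units_mul_sq_sub_one_le _ _).trans
      (card_sq_eq_one_odd_le hp2 (by omega) (β + 1))))
    have hs : 0 < √(p : ℝ) := Real.sqrt_pos.2 hp0
    refine le_of_mul_le_mul_right (h2.trans (le_of_eq ?_)) hs
    have h5 : √((p : ℝ) ^ α) = p ^ β * √p := by
      rw [hβ, pow_succ, Real.sqrt_mul (by positivity), mul_comm 2 β, pow_mul,
        Real.sqrt_sq (by positivity)]
    rw [h5]
    push_cast
    have h6 : √(p : ℝ) * √p = p := Real.mul_self_sqrt hp0.le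
    linear_combination (-2 * (p : ℝ) ^ β) * h6

lemma norm_kl_two_pow_le {α : ℕ} (hα : 0 < α)
    {ψ : AddChar (ZMod (2 ^ α)) ℂ} (hψ : ψ.IsPrimitive) (a : ZMod (2 ^ α)) :
    ‖kl ψ a 1‖ ≤ 8 * √(2 ^ α : ℝ) := by
  set β := (α + 1) / 2
  have hπ : ((2 ^ β : ℕ) : ZMod (2 ^ α)) ^ 2 = 0 := by
    rw [← Nat.cast_pow, ← pow_mul]
    exact (ZMod.natCast_eq_zero_iff _ _).2 (pow_dvd_pow 2 (by omega))
  have h1 := (norm_kl_le_card hψ a _ hπ).trans (Nat.cast_le.2 ((card_units_mul_sq_sub_one_le _ _).trans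
      (card_sq_eq_one_two_le hα β)))
  refine h1.trans ?_
  push_cast
  have h2 : (2 : ℝ) ^ β ≤ 2 * √(2 ^ α) := by
    have h3 : (0 : ℝ) ≤ √(2 ^ α) := Real.sqrt_nonneg _
    refine abs_le_of_sq_le_sq' ?_ (by positivity) |>.2
    rw [mul_pow, Real.sq_sqrt (by positivity), ← pow_mul, ← pow_add]
    exact pow_le_pow_right₀ (by norm_num) (by omega)
  linarith

lemma norm_kl_prime_pow_le {α : ℕ} (hα : 0 < α) [NeZero (p ^ α)]
    {ψ : AddChar (ZMod (p ^ α)) ℂ} (hψ : ψ.IsPrimitive) (a : ZMod (p ^ α)) :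
    ‖kl ψ a 1‖ ≤ 8 * √(p ^ α : ℝ) := by
  have hp : p.Prime := Fact.out
  have hs : 0 ≤ √(p ^ α : ℝ) := Real.sqrt_nonneg _
  by_cases hp2 : p = 2
  · subst hp2
    convert! norm_kl_two_pow_le hα hψ a
  by_cases h2 : 2 ≤ α
  · exact (norm_kl_prime_pow_odd_le hp2 h2 hψ a).trans (by linarith)
  obtain rfl : α = 1 := by omega
  -- The modulus is a variable so that `p ^ 1` can be replaced by the prime p, where the field
  -- structure is available.
  have key : ∀ (q : ℕ) [NeZero q], q = p → ∀ (ψ : AddChar (ZMod q) ℂ), ψ.IsPrimitive →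
      ∀ a : ZMod q, ‖kl ψ a 1‖ ≤ 2 * √q := by
    rintro q _ rfl ψ hψ a
    have hq1 : (1 : ℝ) ≤ √q := Real.one_le_sqrt.2 (by exact_mod_cast hp.one_lt.le)
    by_cases ha : a = 0
    · subst ha
      have h0 : ψ ≠ 1 := by
        have := hψ one_ne_zero
        rwa [AddChar.mulShift_one] at this
      have hsum := AddChar.sum_eq_zero_of_ne_one h0
      have h1 : kl ψ 0 1 = -1 := by
        rw [kl_eq_sum_field]
        have : ∀ x : ZMod q, (if x = 0 then 0 else ψ (0 * x + 1 * x⁻¹)) =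
            ψ x⁻¹ - if x = 0 then 1 else 0 := by
          intro x
          split_ifs with hx <;> simp [hx]
        simp only [this, Finset.sum_sub_distrib, Finset.sum_ite_eq', Finset.mem_univ, if_true]
        have hinv : ∑ x : ZMod q, ψ x⁻¹ = 0 := (Equiv.sum_comp (Equiv.inv (ZMod q)) ψ).trans hsum
        rw [hinv, zero_sub]
      rw [h1, norm_neg, norm_one]
      linarith
    · exact norm_kl_prime_le hp2 hψ ha one_ne_zero
  have := key (p ^ 1) (pow_one p) ψ hψ a
  push_cast at this
  linarith

end PrimePower

/-! ### Chinese remainder theorem and general moduli -/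

section Product

variable {R R₁ R₂ : Type*} [CommRing R] [CommRing R₁] [CommRing R₂]

/-- The restriction of an additive character to the first factor of a product decomposition. -/
noncomputable def charFst (ε : R ≃+* R₁ × R₂) (ψ : AddChar R ℂ) : AddChar R₁ ℂ :=
  ψ.compAddMonoidHom ((ε.symm : R₁ × R₂ →+ R).comp (AddMonoidHom.inl R₁ R₂))

lemma charFst_apply (ε : R ≃+* R₁ × R₂) (ψ : AddChar R ℂ) (x : R₁) :
    charFst ε ψ x = ψ (ε.symm (x, 0)) := rfl

lemma isPrimitive_charFst (ε : R ≃+* R₁ × R₂) {ψ : AddChar R ℂ} (hψ : ψ.IsPrimitive) :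
    (charFst ε ψ).IsPrimitive := by
  intro r hr h
  have h1 : ε.symm (r, 0) ≠ 0 := by
    intro h0
    have := (EmbeddingLike.map_eq_zero_iff (f := ε.symm)).1 h0
    exact hr (congrArg Prod.fst this)
  refine hψ h1 (AddChar.ext _ _ fun x => ?_)
  have h2 := DFunLike.congr_fun h (ε x).1
  rw [AddChar.mulShift_apply, charFst_apply] at h2
  rw [AddChar.mulShift_apply, AddChar.one_apply]
  rw [AddChar.one_apply] at h2
  rw [← h2]
  congr 1
  apply ε.injective
  rw [map_mul, RingEquiv.apply_symm_apply, RingEquiv.apply_symm_apply]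
  ext <;> simp

/-- The usual twists of the arguments are absorbed into the characters. Hence b = 1 stays 1 in both
factors, and the induction in `norm_kl_le` runs over all primitive characters. -/
lemma kl_eq_mul [Fintype R] [Fintype R₁] [Fintype R₂] [DecidableEq R] [DecidableEq R₁]
    [DecidableEq R₂] (ε : R ≃+* R₁ × R₂) (ψ : AddChar R ℂ) (a b : R) :
    kl ψ a b = kl (charFst ε ψ) (ε a).1 (ε b).1 *
      kl (charFst (ε.trans RingEquiv.prodComm) ψ) (ε a).2 (ε b).2 := by
  rw [kl, kl, kl, Finset.sum_mul_sum, ← Fintype.sum_prod_type']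
  refine Fintype.sum_equiv
    ((Units.mapEquiv ε.toMulEquiv).trans MulEquiv.prodUnits).toEquiv _ _ fun u => ?_
  rw [charFst_apply, charFst_apply, ← AddChar.map_add_eq_mul]
  congr 1
  apply ε.injective
  rw [map_add ε (ε.symm _), RingEquiv.apply_symm_apply]
  have : ∀ y : R₂, ε ((ε.trans RingEquiv.prodComm).symm (y, 0)) = (0, y) := fun y => by simp
  rw [this]
  ext <;> simp [MulEquiv.prodUnits] <;> (rw [← map_inv]; rfl)

end Product

lemma norm_kl_le (q : ℕ) : ∀ [NeZero q] {ψ : AddChar (ZMod q) ℂ}, ψ.IsPrimitive → ∀ a : ZMod q,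
    ‖kl ψ a 1‖ ≤ 8 ^ q.primeFactors.card * √q := by
  induction q using Nat.recOnPosPrimePosCoprime with
  | zero => intro h; exact absurd rfl h.out
  | one =>
    intro _ ψ _ a
    rw [kl]
    refine (norm_sum_le _ _).trans ?_
    simp only [AddChar.norm_apply]
    simp
  | prime_pow p α hp hα =>
    intro _ ψ hψ a
    have : Fact p.Prime := ⟨hp⟩
    rw [Nat.primeFactors_prime_pow hα.ne' hp, Finset.card_singleton, pow_one]
    push_cast
    exact norm_kl_prime_pow_le hα hψ a
  | coprime m n hm hn hmn ihm ihn =>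
    intro _ ψ hψ a
    have : NeZero m := ⟨by omega⟩
    have : NeZero n := ⟨by omega⟩
    let ε := ZMod.chineseRemainder hmn
    have h2 : (ε.trans RingEquiv.prodComm).symm.symm = ε.trans RingEquiv.prodComm := rfl
    rw [kl_eq_mul ε, norm_mul, map_one, Prod.fst_one, Prod.snd_one, hmn.primeFactors_mul,
      Finset.card_union_of_disjoint hmn.disjoint_primeFactors, pow_add, Nat.cast_mul,
      Real.sqrt_mul (by positivity)]
    calc _ ≤ (8 ^ m.primeFactors.card * √m) * (8 ^ n.primeFactors.card * √n) :=
          mul_le_mul (ihm (isPrimitive_charFst ε hψ) _) (ihn (isPrimitive_charFst _ hψ) _)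
            (norm_nonneg _) (by positivity)
      _ = _ := by ring

/-- A prime p ≥ 8^(1/δ) satisfies 8 ≤ p^δ; the smaller primes number at most N and cost a constant
factor. -/
lemma pow_card_primeFactors_le {δ : ℝ} (hδ : 0 < δ) :
    ∃ C : ℝ, 0 < C ∧ ∀ q : ℕ, 1 ≤ q → (8 : ℝ) ^ q.primeFactors.card ≤ C * (q : ℝ) ^ δ := by
  obtain ⟨N, hN⟩ := exists_nat_ge ((8 : ℝ) ^ (1 / δ))
  refine ⟨8 ^ N, by positivity, fun q hq => ?_⟩
  have hterm : ∀ p ∈ q.primeFactors, (8 : ℝ) ≤ (p : ℝ) ^ δ * if p < N then 8 else 1 := by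
    intro p hp
    have hp1 : (1 : ℝ) ≤ p := by exact_mod_cast (Nat.prime_of_mem_primeFactors hp).one_lt.le
    split_ifs with h
    · have := Real.one_le_rpow hp1 hδ.le
      linarith
    · rw [mul_one]
      have h1 : (8 : ℝ) ^ (1 / δ) ≤ p := hN.trans (by exact_mod_cast not_lt.1 h)
      have h2 := Real.rpow_le_rpow (by positivity) h1 hδ.le
      rwa [← Real.rpow_mul (by norm_num), one_div_mul_cancel hδ.ne', Real.rpow_one] at h2
  calc (8 : ℝ) ^ q.primeFactors.card = ∏ _p ∈ q.primeFactors, (8 : ℝ) := by rw [Finset.prod_const]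
    _ ≤ ∏ p ∈ q.primeFactors, ((p : ℝ) ^ δ * if p < N then 8 else 1) :=
        Finset.prod_le_prod (fun _ _ => by norm_num) hterm
    _ = (∏ p ∈ q.primeFactors, (p : ℝ)) ^ δ * 8 ^ (q.primeFactors.filter (· < N)).card := by
        rw [Finset.prod_mul_distrib, Real.finsetProd_rpow _ _ (fun _ _ => by positivity),
          Finset.prod_ite, Finset.prod_const, Finset.prod_const_one, mul_one]
    _ ≤ (q : ℝ) ^ δ * 8 ^ N := by
        refine mul_le_mul ?_ ?_ (by positivity) (by positivity)
        · refine Real.rpow_le_rpow (by positivity) ?_ hδ.le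
          rw [← Nat.cast_prod]
          exact Nat.cast_le.2 (Nat.le_of_dvd hq (Nat.prod_primeFactors_dvd q))
        · refine pow_le_pow_right₀ (by norm_num) ?_
          calc _ ≤ (Finset.range N).card := Finset.card_le_card fun p hp =>
                Finset.mem_range.2 (Finset.mem_filter.1 hp).2
            _ = N := Finset.card_range N
    _ = _ := mul_comm _ _

/-! ### Geometric sums and the average over n -/

lemma norm_e (x : ℝ) : ‖e x‖ = 1 := by
  rw [e, show 2 * (Real.pi : ℂ) * Complex.I * x = ((2 * Real.pi * x : ℝ) : ℂ) * Complex.I by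
    push_cast; ring, Complex.norm_exp_ofReal_mul_I]

lemma le_norm_e_sub_one {k q : ℕ} (hk : 0 < k) (hkq : k < q) :
    4 * (min k (q - k) : ℕ) / (q : ℝ) ≤ ‖e ((k : ℝ) / q) - 1‖ := by
  have hq : (0 : ℝ) < q := by exact_mod_cast (by omega : 0 < q)
  have hpi := Real.pi_pos
  have h1 : ‖e ((k : ℝ) / q) - 1‖ = ‖2 * Real.sin (Real.pi * k / q)‖ := by
    rw [e, show 2 * (Real.pi : ℂ) * Complex.I * ((k : ℝ) / q : ℝ) =
      Complex.I * ((2 * (Real.pi * k / q) : ℝ) : ℂ) by push_cast; ring,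
      Complex.norm_exp_I_mul_ofReal_sub_one]
    congr 3
    ring
  have key : ∀ j : ℕ, 2 * j ≤ q → 2 * (j : ℝ) / q ≤ Real.sin (Real.pi * j / q) := by
    intro j hj
    have hj' : 2 * (j : ℝ) ≤ q := by exact_mod_cast hj
    have := Real.mul_le_sin (x := Real.pi * j / q) (by positivity) (by
      rw [div_le_iff₀ hq]; nlinarith)
    refine le_trans (le_of_eq ?_) this
    field_simp
  have h2 : 2 * (min k (q - k) : ℕ) / (q : ℝ) ≤ Real.sin (Real.pi * k / q) := by
    rcases le_total (2 * k) q with h | h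
    · rw [min_eq_left (by omega)]
      exact key k h
    · rw [min_eq_right (by omega)]
      have h3 := key (q - k) (by omega)
      have h4 : Real.pi * ((q - k : ℕ) : ℝ) / q = Real.pi - Real.pi * k / q := by
        rw [Nat.cast_sub hkq.le]
        field_simp
      rwa [h4, Real.sin_pi_sub] at h3
  rw [h1, Real.norm_eq_abs]
  refine le_trans ?_ (le_abs_self _)
  calc 4 * (min k (q - k) : ℕ) / (q : ℝ) = 2 * (2 * (min k (q - k) : ℕ) / (q : ℝ)) := by ring
    _ ≤ _ := mul_le_mul_of_nonneg_left h2 (by norm_num)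

lemma norm_sum_e_le {k q : ℕ} (hk : 0 < k) (hkq : k < q) (N : ℕ) :
    ‖∑ n ∈ Finset.Icc 1 N, e ((k : ℝ) * n / q)‖ ≤ q / 2 * (1 / k + 1 / ((q - k : ℕ) : ℝ)) := by
  have hq : (0 : ℝ) < q := by exact_mod_cast (by omega : 0 < q)
  set ζ := e ((k : ℝ) / q) with hζ
  have hpow : ∀ n : ℕ, e ((k : ℝ) * n / q) = ζ ^ n := by
    intro n
    rw [hζ, e, e, ← Complex.exp_nat_mul]
    congr 1
    push_cast
    ring
  simp only [hpow]
  have hgeom : (∑ n ∈ Finset.Icc 1 N, ζ ^ n) * (ζ - 1) = ζ ^ (N + 1) - ζ := by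
    induction N with
    | zero => simp
    | succ N ih =>
      rw [Finset.sum_Icc_succ_top (by omega), add_mul, ih]
      ring
  have h1 : ‖∑ n ∈ Finset.Icc 1 N, ζ ^ n‖ * ‖ζ - 1‖ ≤ 2 := by
    rw [← norm_mul, hgeom]
    refine (norm_sub_le _ _).trans ?_
    rw [norm_pow, hζ, norm_e, one_pow]
    norm_num
  have h2 := le_norm_e_sub_one hk hkq
  have hk' : (0 : ℝ) < k := by exact_mod_cast hk
  have hqk' : (0 : ℝ) < ((q - k : ℕ) : ℝ) := by exact_mod_cast (by omega : 0 < q - k)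
  have hm : (0 : ℝ) < (min k (q - k) : ℕ) := by exact_mod_cast (by omega : 0 < min k (q - k))
  have h3 : ‖∑ n ∈ Finset.Icc 1 N, ζ ^ n‖ ≤ q / 2 * (1 / (min k (q - k) : ℕ)) := by
    have h4 := (mul_le_mul_of_nonneg_left h2 (norm_nonneg (∑ n ∈ Finset.Icc 1 N, ζ ^ n))).trans h1
    rw [mul_div_assoc', div_le_iff₀ hq] at h4
    rw [mul_one_div, le_div_iff₀ hm]
    linarith
  refine h3.trans (mul_le_mul_of_nonneg_left ?_ (by positivity))
  rcases min_choice k (q - k) with h | h <;> rw [h]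
  · have : (0 : ℝ) ≤ 1 / ((q - k : ℕ) : ℝ) := by positivity
    linarith
  · have : (0 : ℝ) ≤ 1 / (k : ℝ) := by positivity
    linarith

lemma sum_inv_add_inv_sub_le (q : ℕ) :
    ∑ k ∈ Finset.Ico 1 q, (1 / (k : ℝ) + 1 / ((q - k : ℕ) : ℝ)) ≤ 2 * (1 + Real.log q) := by
  have h1 : ∑ k ∈ Finset.Ico 1 q, 1 / ((q - k : ℕ) : ℝ) = ∑ k ∈ Finset.Ico 1 q, 1 / (k : ℝ) := by
    have := Finset.sum_Ico_reflect (fun k => 1 / (k : ℝ)) 1 (Nat.le_succ q)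
    rwa [Nat.add_sub_cancel_left, Nat.add_sub_cancel] at this
  have h2 : ∑ k ∈ Finset.Ico 1 q, 1 / (k : ℝ) ≤ 1 + Real.log q := by
    refine le_trans ?_ (harmonic_le_one_add_log q)
    rw [harmonic_eq_sum_Icc]
    push_cast
    simp only [one_div]
    exact Finset.sum_le_sum_of_subset_of_nonneg
      (fun k hk => by rw [Finset.mem_Ico] at hk; rw [Finset.mem_Icc]; omega)
      fun k _ _ => by positivity
  rw [Finset.sum_add_distrib, h1]
  linarith

/-- The frequency k = 0 is exactly the subtracted main term. The others combine the geometric sum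
bound with the Kloosterman bound, and a harmonic sum produces the logarithm. -/
lemma norm_sum_klAverage_sub_le (q : ℕ) [NeZero q] (N : ℕ) :
    ‖∑ n ∈ Finset.Icc 1 N, klAverage n q - N * ((ArithmeticFunction.moebius q : ℂ) / q)‖ ≤
      8 ^ q.primeFactors.card * √q * (1 + Real.log q) := by
  have hq : 0 < q := NeZero.pos q
  have hq' : (0 : ℝ) < q := by exact_mod_cast hq
  have hqc : (q : ℂ) ≠ 0 := Nat.cast_ne_zero.2 hq.ne'
  set B : ℝ := 8 ^ q.primeFactors.card * √q with hB
  have hS : ∀ k : ℕ, ‖S ((k : ℤ) ^ 2) 1 q‖ ≤ B := fun k => by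
    rw [S_eq_kl, Int.cast_one]
    exact norm_kl_le q (ZMod.isPrimitive_stdAddChar q) _
  have hS0 : S (((0 : ℕ) : ℤ) ^ 2) 1 q = (ArithmeticFunction.moebius q : ℂ) := by
    rw [S_eq_kl, ← kl_zero_one_eq_moebius]
    simp
  have hexp : ∑ n ∈ Finset.Icc 1 N, klAverage n q - N * ((ArithmeticFunction.moebius q : ℂ) / q) =
      1 / (q : ℂ) * ∑ k ∈ Finset.Ico 1 q,
        (∑ n ∈ Finset.Icc 1 N, e ((k : ℝ) * n / q)) * S ((k : ℤ) ^ 2) 1 q := by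
    simp only [klAverage]
    rw [← Finset.mul_sum, Finset.sum_comm, Finset.range_eq_Ico, Finset.sum_eq_sum_Ico_succ_bot hq, hS0]
    simp only [Finset.sum_mul]
    have h0 : ∀ n : ℕ, e (((0 : ℕ) : ℝ) * (n : ℝ) / (q : ℝ)) = 1 := fun n => by simp [e]
    simp only [Int.cast_natCast, h0, one_mul, Finset.sum_const, Nat.card_Icc, Nat.add_sub_cancel,
      nsmul_eq_mul, zero_add]
    ring
  rw [hexp, norm_mul, norm_div, norm_one, Complex.norm_natCast]
  have h1 : ‖∑ k ∈ Finset.Ico 1 q,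
      (∑ n ∈ Finset.Icc 1 N, e ((k : ℝ) * n / q)) * S ((k : ℤ) ^ 2) 1 q‖ ≤
      ∑ k ∈ Finset.Ico 1 q, (q / 2 * (1 / (k : ℝ) + 1 / ((q - k : ℕ) : ℝ))) * B := by
    refine norm_sum_le_of_le _ fun k hk => ?_
    rw [Finset.mem_Ico] at hk
    rw [norm_mul]
    exact mul_le_mul (norm_sum_e_le (by omega) hk.2 N) (hS k) (norm_nonneg _) (by positivity)
  rw [← Finset.sum_mul, ← Finset.mul_sum] at h1
  have hB0 : 0 ≤ B := by positivity
  calc _ ≤ 1 / (q : ℝ) * ((q / 2 * ∑ k ∈ Finset.Ico 1 q, (1 / (k : ℝ) + 1 / ((q - k : ℕ) : ℝ))) * B) :=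
        mul_le_mul_of_nonneg_left h1 (by positivity)
    _ = B * ((∑ k ∈ Finset.Ico 1 q, (1 / (k : ℝ) + 1 / ((q - k : ℕ) : ℝ))) / 2) := by
        field_simp
    _ ≤ B * (1 + Real.log q) := by
        refine mul_le_mul_of_nonneg_left ?_ hB0
        linarith [sum_inv_add_inv_sub_le q]

/-! ### Summation over the decompositions q = c²d -/

lemma eq_of_sq_mul_squarefree_eq {a b c d : ℕ} (hb : Squarefree b) (hd : Squarefree d)
    (h : a ^ 2 * b = c ^ 2 * d) (ha : a ≠ 0) (hc : c ≠ 0) : b = d := by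
  refine Nat.eq_of_factorization_eq hb.ne_zero hd.ne_zero fun p => ?_
  have h1 := congrArg (fun n => n.factorization p) h
  simp only [Nat.factorization_mul (pow_ne_zero 2 ha) hb.ne_zero,
    Nat.factorization_mul (pow_ne_zero 2 hc) hd.ne_zero, Nat.factorization_pow, Finsupp.add_apply,
    Finsupp.smul_apply, smul_eq_mul] at h1
  have h2 := hb.natFactorization_le_one p
  have h3 := hd.natFactorization_le_one p
  omega

/-- μ(d) vanishes unless d is squarefree, and the squarefree part of q is unique. -/
lemma sum_moebius_div_eq {q a b : ℕ} (hq : 1 ≤ q) (hab : q = a ^ 2 * b) (hb : Squarefree b) :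
    ∑ t ∈ q.divisors ×ˢ q.divisors with t.1 ^ 2 * t.2 = q,
      ((ArithmeticFunction.moebius t.2 : ℂ) / t.2) = (ArithmeticFunction.moebius b : ℂ) / b := by
  have ha0 : a ≠ 0 := by rintro rfl; simp at hab; omega
  rw [Finset.sum_eq_single (a, b)]
  · rintro ⟨c, d⟩ h hne
    simp only [Finset.mem_filter, Finset.mem_product, Nat.mem_divisors] at h
    by_cases hd : Squarefree d
    · exfalso
      have hc0 : c ≠ 0 := by rintro rfl; have := h.2; simp at this; omega
      have hbd := eq_of_sq_mul_squarefree_eq hb hd (hab.symm.trans h.2.symm) ha0 hc0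
      subst hbd
      have h1 := Nat.eq_of_mul_eq_mul_right (Nat.pos_of_ne_zero hb.ne_zero) (h.2.trans hab)
      exact hne (by rw [Nat.pow_left_injective two_ne_zero h1])
    · simp [ArithmeticFunction.moebius_eq_zero_of_not_squarefree hd]
  · intro h
    refine absurd (Finset.mem_filter.2 ⟨Finset.mem_product.2 ⟨Nat.mem_divisors.2 ⟨?_, by omega⟩,
      Nat.mem_divisors.2 ⟨?_, by omega⟩⟩, hab.symm⟩) h
    · exact ⟨a * b, by rw [hab]; ring⟩
    · exact ⟨a ^ 2, by rw [hab]; ring⟩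

lemma exists_bound_mul_one_add_log {δ : ℝ} (hδ : 0 < δ) :
    ∃ C : ℝ, 0 < C ∧ ∀ q : ℕ, 1 ≤ q → 8 ^ q.primeFactors.card * √q * (1 + Real.log q) ≤
      C * (q : ℝ) ^ (1 / 2 + δ) := by
  -- Half of δ pays for 8^ω(q), the other half for the logarithm.
  obtain ⟨C, hC, h⟩ := pow_card_primeFactors_le (half_pos hδ)
  refine ⟨C * (1 + 1 / (δ / 2)), by positivity, fun q hq => ?_⟩
  have hq0 : (0 : ℝ) < q := by exact_mod_cast hq
  have hq1 : (1 : ℝ) ≤ q := by exact_mod_cast hq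
  have h1 : 1 + Real.log q ≤ (1 + 1 / (δ / 2)) * (q : ℝ) ^ (δ / 2) := by
    have h2 := Real.log_le_rpow_div hq0.le (half_pos hδ)
    have h3 := Real.one_le_rpow hq1 (half_pos hδ).le
    rw [add_mul, one_mul, one_div_mul_eq_div]
    linarith
  have hlog : 0 ≤ 1 + Real.log q := by have := Real.log_nonneg hq1; linarith
  calc _ ≤ C * (q : ℝ) ^ (δ / 2) * √q * ((1 + 1 / (δ / 2)) * (q : ℝ) ^ (δ / 2)) :=
        mul_le_mul (mul_le_mul_of_nonneg_right (h q hq) (Real.sqrt_nonneg _)) h1 hlog (by positivity)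
    _ = _ := by
        rw [show 1 / 2 + δ = 1 / 2 + δ / 2 + δ / 2 by ring, Real.rpow_add hq0, Real.rpow_add hq0,
          Real.sqrt_eq_rpow]
        ring

/-- Writing d = q/c² leaves a convergent series in c, so no divisor bound is needed. -/
lemma sum_rpow_le {δ : ℝ} (hδ : 0 < δ) {q : ℕ} (hq : 1 ≤ q) :
    ∑ t ∈ q.divisors ×ˢ q.divisors with t.1 ^ 2 * t.2 = q, (t.2 : ℝ) ^ (1 / 2 + δ) ≤
      (∑' n : ℕ, 1 / (n : ℝ) ^ (1 + 2 * δ)) * (q : ℝ) ^ (1 / 2 + δ) := by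
  have hsum : Summable fun n : ℕ => 1 / (n : ℝ) ^ (1 + 2 * δ) :=
    Real.summable_one_div_nat_rpow.2 (by linarith)
  set s := (q.divisors ×ˢ q.divisors).filter fun t => t.1 ^ 2 * t.2 = q
  have hterm : ∀ t ∈ s, (t.2 : ℝ) ^ (1 / 2 + δ) =
      1 / (t.1 : ℝ) ^ (1 + 2 * δ) * (q : ℝ) ^ (1 / 2 + δ) := by
    rintro ⟨c, d⟩ ht
    obtain ⟨hm, h⟩ := Finset.mem_filter.1 ht
    have hc : (0 : ℝ) < c := by
      exact_mod_cast Nat.pos_of_mem_divisors (Finset.mem_product.1 hm).1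
    dsimp only at h ⊢
    rw [← h]
    push_cast
    rw [Real.mul_rpow (by positivity) (by positivity), ← Real.rpow_natCast, ← Real.rpow_mul hc.le,
      show ((2 : ℕ) : ℝ) * (1 / 2 + δ) = 1 + 2 * δ by push_cast; ring]
    have : (c : ℝ) ^ (1 + 2 * δ) ≠ 0 := (Real.rpow_pos_of_pos hc _).ne'
    field_simp
  have hinj : Set.InjOn Prod.fst (s : Set (ℕ × ℕ)) := by
    rintro ⟨c, d⟩ h ⟨c', d'⟩ h' hcc
    obtain ⟨hm, h⟩ := Finset.mem_filter.1 (Finset.mem_coe.1 h)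
    obtain ⟨-, h'⟩ := Finset.mem_filter.1 (Finset.mem_coe.1 h')
    dsimp only at h h' hcc
    subst hcc
    have hc : 0 < c := Nat.pos_of_mem_divisors (Finset.mem_product.1 hm).1
    rw [Nat.eq_of_mul_eq_mul_left (by positivity) (h.trans h'.symm)]
  rw [Finset.sum_congr rfl hterm, ← Finset.sum_mul]
  refine mul_le_mul_of_nonneg_right ?_ (by positivity)
  rw [← Finset.sum_image (f := fun n : ℕ => 1 / (n : ℝ) ^ (1 + 2 * δ)) hinj]
  exact hsum.sum_le_tsum _ fun n _ => by positivity

theorem exists_abs_sum_lam_sub_le {δ : ℝ} (hδ : 0 < δ) :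
    ∃ C : ℝ, ∀ q a b : ℕ, 1 ≤ q → q = a ^ 2 * b → Squarefree b → ∀ z : ℝ, 2 ≤ z →
      |((∑ n ∈ Finset.Icc 1 ⌊z⌋₊, lam q ((n : ℤ) ^ 2 - 4) : ℤ) : ℝ) -
          z * ((ArithmeticFunction.moebius b : ℝ) / (b : ℝ))| ≤ C * (q : ℝ) ^ (1 / 2 + δ) := by
  obtain ⟨C, hC, hbound⟩ := exists_bound_mul_one_add_log hδ
  -- The final + 1 pays for replacing ⌊z⌋ by z in the main term.
  refine ⟨C * (∑' n : ℕ, 1 / (n : ℝ) ^ (1 + 2 * δ)) + 1, fun q a b hq hab hb z hz => ?_⟩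
  set N := ⌊z⌋₊
  set s := (q.divisors ×ˢ q.divisors).filter fun t => t.1 ^ 2 * t.2 = q with hs
  have hμ : |(ArithmeticFunction.moebius b : ℝ) / (b : ℝ)| ≤ 1 := by
    have hb1 : (1 : ℝ) ≤ b := by exact_mod_cast Nat.one_le_iff_ne_zero.2 hb.ne_zero
    have h1 : |(ArithmeticFunction.moebius b : ℝ)| ≤ 1 := by
      exact_mod_cast ArithmeticFunction.abs_moebius_le_one (n := b)
    rw [abs_div, abs_of_pos (by linarith : (0 : ℝ) < b), div_le_one (by linarith)]
    linarith
  have hcomplex : ((((∑ n ∈ Finset.Icc 1 N, lam q ((n : ℤ) ^ 2 - 4) : ℤ) : ℝ) -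
      N * ((ArithmeticFunction.moebius b : ℝ) / (b : ℝ)) : ℝ) : ℂ) =
      ∑ t ∈ s, (∑ n ∈ Finset.Icc 1 N, klAverage n t.2 -
        N * ((ArithmeticFunction.moebius t.2 : ℂ) / t.2)) := by
    rw [Finset.sum_sub_distrib, ← Finset.mul_sum, sum_moebius_div_eq hq hab hb, Finset.sum_comm]
    push_cast
    congr 1
    exact Finset.sum_congr rfl fun n _ => lam_eq_sum_klAverage q hq n
  have h1 : |((∑ n ∈ Finset.Icc 1 N, lam q ((n : ℤ) ^ 2 - 4) : ℤ) : ℝ) -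
      N * ((ArithmeticFunction.moebius b : ℝ) / (b : ℝ))| ≤
      C * (∑' n : ℕ, 1 / (n : ℝ) ^ (1 + 2 * δ)) * (q : ℝ) ^ (1 / 2 + δ) := by
    rw [← Real.norm_eq_abs, ← Complex.norm_real, hcomplex]
    calc _ ≤ ∑ t ∈ s, C * (t.2 : ℝ) ^ (1 / 2 + δ) := by
          refine norm_sum_le_of_le _ fun t ht => ?_
          have hm := (Finset.mem_product.1 (Finset.mem_filter.1 ht).1).2
          have hpos := Nat.pos_of_mem_divisors hm
          have : NeZero t.2 := ⟨hpos.ne'⟩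
          exact (norm_sum_klAverage_sub_le t.2 N).trans (hbound t.2 hpos)
      _ ≤ _ := by
          rw [← Finset.mul_sum, mul_assoc]
          exact mul_le_mul_of_nonneg_left (sum_rpow_le hδ hq) hC.le
  have h2 : |(N : ℝ) - z| ≤ 1 := by
    have h3 := Nat.floor_le (by linarith : 0 ≤ z)
    have h4 := Nat.lt_floor_add_one z
    rw [abs_le]
    constructor <;> linarith
  have h5 : (1 : ℝ) ≤ (q : ℝ) ^ (1 / 2 + δ) :=
    Real.one_le_rpow (by exact_mod_cast hq) (by linarith)
  set m := (ArithmeticFunction.moebius b : ℝ) / (b : ℝ)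
  set T := ((∑ n ∈ Finset.Icc 1 N, lam q ((n : ℤ) ^ 2 - 4) : ℤ) : ℝ)
  calc |T - z * m| = |(T - N * m) + (N - z) * m| := by congr 1; ring
    _ ≤ |T - N * m| + |(N - z) * m| := abs_add_le _ _
    _ ≤ C * (∑' n : ℕ, 1 / (n : ℝ) ^ (1 + 2 * δ)) * (q : ℝ) ^ (1 / 2 + δ) + 1 := by
        refine add_le_add h1 ?_
        rw [abs_mul]
        exact mul_le_one₀ h2 (abs_nonneg _) hμ
    _ ≤ _ := by rw [add_mul, one_mul]; linarith

end KloostermanLambda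

theorem lemma2p3 :
    (∀ q n : ℕ, 1 ≤ q → 3 ≤ n →
      (KloostermanLambda.rho q ((n : ℤ) ^ 2 - 4) : ℂ) =
        1 / (q : ℂ) * ∑ k ∈ Finset.range q,
          KloostermanLambda.e ((k : ℝ) * (n : ℝ) / (q : ℝ)) *
            KloostermanLambda.S (k : ℤ) (k : ℤ) q) ∧
    (∀ q n : ℕ, 1 ≤ q → 3 ≤ n →
      (KloostermanLambda.lam q ((n : ℤ) ^ 2 - 4) : ℂ) =
        ∑ t ∈ q.divisors ×ˢ q.divisors with t.1 ^ 2 * t.2 = q,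
          1 / (t.2 : ℂ) * ∑ k ∈ Finset.range t.2,
            KloostermanLambda.e ((k : ℝ) * (n : ℝ) / (t.2 : ℝ)) *
              KloostermanLambda.S ((k : ℤ) ^ 2) 1 t.2) ∧
    (∀ ε : ℝ, 0 < ε → ∃ C : ℝ, ∀ q a b : ℕ, 1 ≤ q → q = a ^ 2 * b → Squarefree b →
      ∀ z : ℝ, 2 ≤ z →
        |((∑ n ∈ Finset.Icc 1 ⌊z⌋₊, KloostermanLambda.lam q ((n : ℤ) ^ 2 - 4) : ℤ) : ℝ) -
            z * ((ArithmeticFunction.moebius b : ℝ) / (b : ℝ))| ≤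
          C * (q : ℝ) ^ (1 / 2 + ε)) := by
  refine ⟨fun q n hq _ => ?_, fun q n hq _ => ?_,
    fun ε hε => KloostermanLambda.exists_abs_sum_lam_sub_le hε⟩
  · have : NeZero q := ⟨by omega⟩
    have h := KloostermanLambda.rho_eq_sum_S q n
    simpa only [Int.cast_natCast] using h
  · have h := KloostermanLambda.lam_eq_sum_klAverage q hq n
    simpa only [KloostermanLambda.klAverage, Int.cast_natCast] using h
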